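/- Let $d \ge 1$ be an integer, regarded as a constant. A $d$-uniform hypergraph $\mathcal H = (U,\mathcal F)$ on a known set $U$ of $n \ge 1$ vertices can be accessed only through an oracle. For $A_1,\dots,A_d \subseteq U$ let $m(A_1,\dots,A_d)$ be the number of hyperedges of the form $\{v_1,\dots,v_d\}$ with $v_i \in A_i$ for all $i$. A $\mathrm{GPIS}_1$ query consists of pairwise disjoint $A_1,\dots,A_s\subseteq U$ and integers $a_1,\dots,a_s\ge 1$ with $\sum_i a_i = d$, and asks whether $m(A_1^{[a_1]},\dots,A_s^{[a_s]}) \ne 0$, where $A^{[a]}$ denotes $a$ copies of $A$. A $\mathrm{GPIS}_2$ query consists of arbitrary $A_1,\dots,A_d\subseteq U$ and asks whether $m(A_1,\dots,A_d)\neq 0$. Let $m(\mathcal H)=|\mathcal F|$, and let $m_o(\mathcal H)$ be the number of ordered hyperedges, i.e. of pairs of a hyperedge and an ordering of its $d$ vertices. There is a constant $C_d>0$, depending only on $d$, such that for every such vertex set $U$ and every $\epsilon\in(0,1)$ with $\epsilon \ge \left(n^{-d}\log^{5d+5} n\right)^{1/4}$ there is a randomized adaptive query algorithm with the following property. On every $d$-uniform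 hypergraph $\mathcal H$ with vertex set $U$ it makes at most $C_d\,\epsilon^{-4}\log^{5d+4} n$ queries, each of which is a $\mathrm{GPIS}_1$ or a $\mathrm{GPIS}_2$ query, and with probability at least $1-n^{-4d}$ its output $\widehat m$ is a $(1\pm\epsilon)$-approximation of $m_o(\mathcal H)$, i.e. $|m_o(\mathcal H)-\widehat m|\le \epsilon\, m_o(\mathcal H)$, so that $\widehat m/d!$ is a $(1\pm\epsilon)$-approximation of $m(\mathcal H)$. -/

import Mathlib

namespace HyperedgeEstimation

universe u

/-- `H` is `d`-uniform: every hyperedge has exactly `d` vertices. -/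
def IsUniform {V : Type u} (H : Hypergraph V) (d : ℕ) : Prop :=
  ∀ e ∈ H.edgeSet, e.Finite ∧ e.ncard = d

/-- The ordered hyperedges of the sub-hypergraph `H(A)` for a family `A` of vertex sets: an
ordering `f` (indexed by `ι`) of the vertices of a hyperedge, without repetition, whose `i`-th
vertex lies in `A i`. -/
def orderedHyperedges {V : Type u} (H : Hypergraph V) {ι : Type} (A : ι → Set V) :
    Set (ι → V) :=
  {f | Function.Injective f ∧ Set.range f ∈ H.edgeSet ∧ ∀ i, f i ∈ A i}

/-- The hyperedges of the sub-hypergraph `H(A)`: the hyperedges of `H` of the form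
`{v i | i}` with `v i ∈ A i`. -/
def hyperedges {V : Type u} (H : Hypergraph V) {ι : Type} (A : ι → Set V) : Set (Set V) :=
  Set.range '' orderedHyperedges H A

/-- `m(A)`, the number of hyperedges of `H(A)`. -/
noncomputable def numHyperedges {V : Type u} (H : Hypergraph V) {ι : Type} (A : ι → Set V) : ℕ :=
  (hyperedges H A).ncard

/-- `m_o(A)`, the number of ordered hyperedges of `H(A)`. -/
noncomputable def numOrderedHyperedges {V : Type u} (H : Hypergraph V) {ι : Type}
    (A : ι → Set V) : ℕ :=
  (orderedHyperedges H A).ncard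

/-- `m_o(H) = m_o(U, …, U)` (`d` copies of the vertex set), for a `d`-uniform hypergraph `H`. -/
noncomputable def totalOrdered {V : Type u} (H : Hypergraph V) (d : ℕ) : ℕ :=
  numOrderedHyperedges H (fun _ : Fin d => H.vertexSet)

/-- The queries about a `d`-uniform hypergraph with vertex set `V`. -/
inductive Query (V : Type u) (d : ℕ) : Type u
  /-- A `GPIS₁` query: pairwise disjoint vertex sets `A 0, …, A (s-1)` with positive
  multiplicities `a 0, …, a (s-1)` that add up to `d`. -/
  | gpis₁ (s : ℕ) (A : Fin s → Set V) (a : Fin s → ℕ)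
      (disjoint : Pairwise fun i j => Disjoint (A i) (A j))
      (pos : ∀ i, 1 ≤ a i) (sum_eq : ∑ i, a i = d) : Query V d
  /-- A `GPIS₂` query: any `d` vertex sets. -/
  | gpis₂ (A : Fin d → Set V) : Query V d

open Classical in
/-- The oracle for `H`: it answers *yes* if and only if `m ≠ 0` for the queried family. In a
`GPIS₁` query the family contains `A i` exactly `a i` times. -/
noncomputable def oracle {V : Type u} {d : ℕ} (H : Hypergraph V) : Query V d → Bool
  | .gpis₁ s A a _ _ _ => decide (numHyperedges H (fun p : (i : Fin s) × Fin (a i) => A p.1) ≠ 0)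
  | .gpis₂ A => decide (numHyperedges H A ≠ 0)

/-- A randomized adaptive query algorithm with queries in `Q` and output in `R`: at each step it
stops with an output, or asks a query and continues according to the yes/no answer, or draws a
random number, independent of the past draws, from a distribution of its choice and continues
according to the drawn number. -/
inductive RandAlg (Q : Type u) (R : Type) : Type u
  | output (r : R) : RandAlg Q R
  | ask (q : Q) (next : Bool → RandAlg Q R) : RandAlg Q R
  | sample (p : PMF ℕ) (next : ℕ → RandAlg Q R) : RandAlg Q R

/-- The joint distribution of the output and the number of queries asked, when the queries are
answered by `O`. -/
noncomputable def RandAlg.run {Q : Type u} {R : Type} (O : Q → Bool) : RandAlg Q R → PMF (R × ℕ)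
  | .output r => PMF.pure (r, 0)
  | .ask q next => ((next (O q)).run O).map fun x => (x.1, x.2 + 1)
  | .sample p next => p.bind fun i => (next i).run O

/-- `a` is a `(1 ± ε)`-approximation of `b`. -/
def IsApprox (ε a b : ℝ) : Prop := |b - a| ≤ ε * b

end HyperedgeEstimation

/-! Once the vertices are numbered, the ordered hyperedges form a finite set S of points in the grid
[n]^d, and a GPIS₂ query tells whether a box, a product of d arbitrary vertex sets, meets S. It
therefore suffices to estimate |S| from box queries.

Subsampling gives a coarse estimate. Let random hash functions keep each value of coordinate i with
probability 2^(-q i). By the union bound some point of S survives with probability at most |S| /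
2^(∑ q i), so scales far above |S| mostly answer no (`card_hits_le`). Conversely, `exists_scale`
sorts the points by the dyadic size of their fibres and inducts on d to find a scale that is at most
polylogarithmically below |S| and mostly answers yes. Hence the largest scale with a majority of yes
answers is correct up to a polylogarithmic factor (`estimate_fails`).

Importance sampling removes this factor. Begin with the cell of side 2^ℓ, where ℓ = ⌈log₂ n⌉. In
each round split the current L weighted cells into halves along every axis, estimate the parts
coarsely, draw L parts with probability proportional to weight times estimate, and reweight. The new
mass is unbiased and its terms are bounded thanks to the coarse estimates, so an exponential tail
bound gives relative error η = ε / (2ℓ) per round (`iid_weightPMF`). After ℓ rounds the cells are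
points, which single queries settle. With L of order ℓ^(2d+3) / ε² and about ℓ^(d+1) queries per
part, the ℓ rounds cost about ℓ^(3d+5) / ε² queries. -/

namespace HyperedgeEstimation

universe u v

open scoped ENNReal NNReal

/-! ### Query algorithms: composition, failure probability and query count -/

/-- Sequential composition of algorithms. -/
noncomputable def RandAlg.bind {Q : Type u} {R R' : Type} :
    RandAlg Q R → (R → RandAlg Q R') → RandAlg Q R'
  | .output r, f => f r
  | .ask q next, f => .ask q fun b => (next b).bind f
  | .sample p next, f => .sample p fun i => (next i).bind f

theorem RandAlg.run_bind {Q : Type u} {R R' : Type} (O : Q → Bool) (a : RandAlg Q R)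
    (f : R → RandAlg Q R') :
    (a.bind f).run O =
      (a.run O).bind fun x => ((f x.1).run O).map fun y => (y.1, x.2 + y.2) := by
  induction a with
  | output r =>
    simp only [bind, run, PMF.pure_bind, zero_add]
    exact (PMF.map_id _).symm
  | ask q next ih =>
    simp only [bind, run, ih, PMF.map_bind, PMF.bind_map, PMF.map_comp]
    congr 1
    funext x
    simp only [Function.comp_def]
    congr 1
    funext y
    rw [Nat.add_right_comm]
  | sample p next ih => simp only [bind, run, ih, PMF.bind_bind]

/-- With answers from `O`, the output violates `P` with probability at most `δ`. -/
def Succeeds {Q : Type u} {R : Type} (O : Q → Bool) (a : RandAlg Q R) (P : R → Prop)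
    (δ : ℝ≥0∞) : Prop :=
  (a.run O).toOuterMeasure {x | ¬ P x.1} ≤ δ

/-- With answers from `O`, the algorithm never asks more than `N` queries. -/
def QueryBound {Q : Type u} {R : Type} (O : Q → Bool) (a : RandAlg Q R) (N : ℕ) : Prop :=
  ∀ x ∈ (a.run O).support, x.2 ≤ N

theorem Succeeds.output {Q : Type u} {R : Type} (O : Q → Bool) {P : R → Prop} {r : R} (h : P r) :
    Succeeds O (RandAlg.output r) P 0 := by
  simp [Succeeds, RandAlg.run, h]

theorem QueryBound.output {Q : Type u} {R : Type} (O : Q → Bool) (r : R) :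
    QueryBound O (RandAlg.output r) 0 := by
  simp [QueryBound, RandAlg.run]

theorem Succeeds.mono {Q : Type u} {R : Type} {O : Q → Bool} {a : RandAlg Q R} {P P' : R → Prop}
    {δ δ' : ℝ≥0∞} (h : Succeeds O a P δ) (hP : ∀ r, P r → P' r) (hδ : δ ≤ δ') :
    Succeeds O a P' δ' := by
  refine le_trans ((a.run O).toOuterMeasure.mono ?_) (h.trans hδ)
  exact fun x hx hP' => hx (hP _ hP')

theorem QueryBound.mono {Q : Type u} {R : Type} {O : Q → Bool} {a : RandAlg Q R} {N N' : ℕ}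
    (h : QueryBound O a N) (hN : N ≤ N') : QueryBound O a N' :=
  fun x hx => (h x hx).trans hN

/-- Union bound: the bad results of the first stage have mass at most `δ`, and after each good
result the second stage fails with probability at most `δ'`. The second bound is uniform over good
results, so adaptivity costs nothing. -/
theorem Succeeds.bind {Q : Type u} {R R' : Type} {O : Q → Bool} {a : RandAlg Q R}
    {f : R → RandAlg Q R'} {P : R → Prop} {P' : R' → Prop} {δ δ' : ℝ≥0∞}
    (ha : Succeeds O a P δ) (hf : ∀ r, P r → Succeeds O (f r) P' δ') :
    Succeeds O (a.bind f) P' (δ + δ') := by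
  unfold Succeeds
  rw [RandAlg.run_bind, PMF.toOuterMeasure_bind_apply]
  calc ∑' x, (a.run O) x * _
      ≤ ∑' x, ({x | ¬ P x.1}.indicator (a.run O) x + (a.run O) x * δ') := by
        refine ENNReal.tsum_le_tsum fun x => ?_
        by_cases hx : P x.1
        · refine le_add_left (mul_le_mul_right ?_ _)
          rw [PMF.toOuterMeasure_map_apply]
          exact hf _ hx
        · rw [Set.indicator_of_mem (by exact hx)]
          refine le_add_right ((mul_le_mul_right (c := 1) ?_ _).trans (mul_one _).le)
          rw [PMF.toOuterMeasure_apply]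
          exact (ENNReal.tsum_le_tsum fun y => Set.indicator_le_self _ _ y).trans
            (PMF.tsum_coe (PMF.map (fun y => (y.1, x.2 + y.2)) ((f x.1).run O))).le
    _ ≤ δ + δ' := by
        rw [ENNReal.tsum_add, ENNReal.tsum_mul_right, PMF.tsum_coe, one_mul,
          ← PMF.toOuterMeasure_apply]
        gcongr
        exact ha

theorem QueryBound.bind {Q : Type u} {R R' : Type} {O : Q → Bool} {a : RandAlg Q R}
    {f : R → RandAlg Q R'} {N N' : ℕ} (ha : QueryBound O a N)
    (hf : ∀ r, QueryBound O (f r) N') : QueryBound O (a.bind f) (N + N') := by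
  intro x hx
  rw [RandAlg.run_bind, PMF.mem_support_bind_iff] at hx
  obtain ⟨y, hy, hx⟩ := hx
  rw [PMF.mem_support_map_iff] at hx
  obtain ⟨z, hz, rfl⟩ := hx
  exact add_le_add (ha y hy) (hf _ z hz)

/-- Ask the queries `q j` for all `j` in a list, and record the answers. -/
noncomputable def askList {Q : Type u} {J : Type} [DecidableEq J] (q : J → Q) :
    List J → (J → Bool) → RandAlg Q (J → Bool)
  | [], acc => .output acc
  | j :: l, acc => .ask (q j) fun b => askList q l (Function.update acc j b)

theorem run_askList {Q : Type u} {J : Type} [DecidableEq J] (q : J → Q) (O : Q → Bool)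
    (l : List J) (acc : J → Bool) :
    (askList q l acc).run O = PMF.pure (fun j => if j ∈ l then O (q j) else acc j, l.length) := by
  induction l generalizing acc with
  | nil => simp [askList, RandAlg.run]
  | cons j l ih =>
    simp only [askList, RandAlg.run, ih, PMF.pure_map, List.length_cons]
    congr 2
    funext k
    by_cases hk : k ∈ l
    · simp [hk]
    · by_cases hkj : k = j
      · subst hkj; simp [hk]
      · simp [hk, hkj]

open Classical in
/-- Ask all queries of a finite family. -/
noncomputable def askAll {Q : Type u} {J : Type} [Fintype J] (q : J → Q) :
    RandAlg Q (J → Bool) :=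
  askList q Finset.univ.toList fun _ => false

theorem run_askAll {Q : Type u} {J : Type} [Fintype J] (q : J → Q) (O : Q → Bool) :
    (askAll q).run O = PMF.pure (fun j => O (q j), Fintype.card J) := by
  simp [askAll, run_askList]

theorem Succeeds.askAll {Q : Type u} {J : Type} [Fintype J] (q : J → Q) (O : Q → Bool) :
    Succeeds O (askAll q) (fun ans => ans = fun j => O (q j)) 0 := by
  simp [Succeeds, run_askAll]

theorem QueryBound.askAll {Q : Type u} {J : Type} [Fintype J] (q : J → Q) (O : Q → Bool) :
    QueryBound O (askAll q) (Fintype.card J) := by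
  simp [QueryBound, run_askAll]

/-- Draw from a distribution on a countable type. -/
noncomputable def draw {Q : Type u} {K : Type} [Countable K] (p : PMF K) : RandAlg Q K :=
  -- Algorithms sample natural numbers only, so `K` is encoded by an injection and decoded
  -- afterwards.
  .sample (p.map (exists_injective_nat K).choose) fun i =>
    haveI : Nonempty K := p.support_nonempty.nonempty
    .output (Function.invFun (exists_injective_nat K).choose i)

theorem run_draw {Q : Type u} {K : Type} [Countable K] (p : PMF K) (O : Q → Bool) :
    (draw p).run O = p.map fun k => (k, 0) := by
  have : Nonempty K := p.support_nonempty.nonempty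
  have h := Function.leftInverse_invFun (exists_injective_nat K).choose_spec
  simp only [draw, RandAlg.run, PMF.bind_map, Function.comp_def, h _]
  rfl

theorem Succeeds.draw {Q : Type u} {K : Type} [Countable K] {p : PMF K}
    {P : K → Prop} {δ : ℝ≥0∞} (h : p.toOuterMeasure {k | ¬ P k} ≤ δ) (O : Q → Bool) :
    Succeeds O (draw p) P δ := by
  rw [Succeeds, run_draw, PMF.toOuterMeasure_map_apply]
  exact h

theorem QueryBound.draw {Q : Type u} {K : Type} [Countable K] (p : PMF K)
    (O : Q → Bool) : QueryBound O (draw p) 0 := by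
  rw [QueryBound, run_draw]
  intro x hx
  rw [PMF.mem_support_map_iff] at hx
  obtain ⟨k, -, rfl⟩ := hx
  exact le_rfl

/-- Translate the queries of an algorithm. -/
def RandAlg.mapQuery {Q : Type u} {Q' : Type v} {R : Type} (φ : Q → Q') :
    RandAlg Q R → RandAlg Q' R
  | .output r => .output r
  | .ask q next => .ask (φ q) fun b => (next b).mapQuery φ
  | .sample p next => .sample p fun i => (next i).mapQuery φ

theorem RandAlg.run_mapQuery {Q : Type u} {Q' : Type v} {R : Type} (φ : Q → Q') (O : Q' → Bool)
    (a : RandAlg Q R) : (a.mapQuery φ).run O = a.run (O ∘ φ) := by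
  induction a with
  | output r => rfl
  | ask q next ih => simp only [mapQuery, run, ih, Function.comp_apply]
  | sample p next ih => simp only [mapQuery, run, ih]

/-! ### Independent draws and tail bounds -/

/-- The distribution of a family of independent draws from `p`. -/
noncomputable def iid {K : Type} [Fintype K] (p : PMF K) (r : ℕ) : PMF (Fin r → K) :=
  PMF.ofFintype (fun f => ∏ i, p (f i)) (by
    rw [← Fintype.sum_pow, ← tsum_fintype (L := .unconditional _), PMF.tsum_coe, one_pow])

/-- Markov's inequality for a product of independent factors, whose expectation is the product of
the expectations. Both tail bounds below follow by a choice of `g`. -/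
theorem iid_markov {K : Type} [Fintype K] (p : PMF K) (r : ℕ) (g : K → ℝ≥0∞) (t : ℝ≥0∞) :
    (iid p r).toOuterMeasure {f | t ≤ ∏ i, g (f i)} * t ≤ (∑ k, p k * g k) ^ r := by
  rw [PMF.toOuterMeasure_apply_fintype, Finset.sum_mul, Fintype.sum_pow]
  refine Finset.sum_le_sum fun f _ => ?_
  rw [Finset.prod_mul_distrib]
  by_cases hf : t ≤ ∏ i, g (f i)
  · rw [Set.indicator_of_mem (by exact hf)]
    exact mul_le_mul_right hf _
  · rw [Set.indicator_of_notMem (by exact hf), zero_mul]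
    exact zero_le

open Classical in
/-- If an event is unlikely, it hardly ever happens in half of many independent trials. -/
theorem iid_majority {K : Type} [Fintype K] (p : PMF K) (r : ℕ) (B : Set K)
    (hB : p.toOuterMeasure B * 16 ≤ 1) :
    (iid p r).toOuterMeasure {f | r ≤ 2 * (Finset.univ.filter fun i => f i ∈ B).card} ≤
      2⁻¹ ^ r := by
  -- The mean of `g` is at most 1 + 1 = 2, while hitting `B` in half of the trials makes the product
  -- at least 16^(r/2) = 4^r; Markov leaves (2/4)^r.
  set g : K → ℝ≥0∞ := fun k => if k ∈ B then 16 else 1 with hg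
  have hprod (f : Fin r → K) :
      ∏ i, g (f i) = 16 ^ (Finset.univ.filter fun i => f i ∈ B).card := by
    simp [hg, Finset.prod_ite]
  have hsum : ∑ k, p k * g k ≤ 2 := by
    have h1 : ∀ k, p k * g k ≤ B.indicator p k * 16 + p k := by
      intro k
      by_cases hk : k ∈ B
      · simp [hg, hk]
      · simp [hg, hk]
    refine (Finset.sum_le_sum fun k _ => h1 k).trans ?_
    rw [Finset.sum_add_distrib, ← Finset.sum_mul, ← PMF.toOuterMeasure_apply_fintype,
      ← tsum_fintype (L := .unconditional _) (f := fun k => p k), PMF.tsum_coe]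
    calc _ ≤ (1 : ℝ≥0∞) + 1 := by gcongr
      _ = 2 := one_add_one_eq_two
  have hmarkov := iid_markov p r g (4 ^ r)
  have hsub : {f : Fin r → K | r ≤ 2 * (Finset.univ.filter fun i => f i ∈ B).card} ⊆
      {f | 4 ^ r ≤ ∏ i, g (f i)} := by
    intro f hf
    have hf : r ≤ 2 * (Finset.univ.filter fun i => f i ∈ B).card := hf
    show 4 ^ r ≤ ∏ i, g (f i)
    rw [hprod, show (16 : ℝ≥0∞) = 4 ^ 2 by norm_num, ← pow_mul]
    exact pow_le_pow_right₀ (by norm_num) hf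
  have h4 : (4 : ℝ≥0∞) ^ r ≠ 0 := by positivity
  have h4' : (4 : ℝ≥0∞) ^ r ≠ ⊤ := ENNReal.pow_ne_top (by norm_num)
  refine ((iid p r).toOuterMeasure.mono hsub).trans ?_
  have h5 := hmarkov.trans (pow_le_pow_left₀ (zero_le) hsum r)
  rw [← ENNReal.le_div_iff_mul_le (Or.inl h4) (Or.inl h4')] at h5
  refine h5.trans (le_of_eq ?_)
  rw [show (4 : ℝ≥0∞) = 2 * 2 by norm_num, mul_pow, ← ENNReal.inv_pow, div_eq_mul_inv,
    ENNReal.mul_inv (by left; positivity) (by left; exact ENNReal.pow_ne_top (by norm_num)), ← mul_assoc,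
    ENNReal.mul_inv_cancel (by positivity) (ENNReal.pow_ne_top (by norm_num)), one_mul]

/-- An exponential tail bound for sums of independent bounded centred variables. -/
theorem iid_tail {K : Type} [Fintype K] (p : PMF K) (r : ℕ) (x : K → ℝ) {β η : ℝ} (hβ : 1 ≤ β)
    (hη : 0 < η) (hη1 : η ≤ 1) (hx : ∀ k, |x k| ≤ β) (hmean : ∑ k, (p k).toReal * x k = 0) :
    (iid p r).toOuterMeasure {f | η * r ≤ ∑ i, x (f i)} ≤
      ENNReal.ofReal (Real.exp (-(r * η ^ 2 / (4 * β ^ 2)))) := by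
  -- This maximises the exponent s η - s² β², with value η² / (4 β²). It also gives s β ≤ 1, the
  -- range in which exp y ≤ 1 + y + y² is applied.
  set s : ℝ := η / (2 * β ^ 2) with hs
  have hs0 : 0 < s := by positivity
  have hsβ : s * β ≤ 1 := by
    rw [hs, div_mul_eq_mul_div, div_le_one (by positivity)]
    nlinarith
  have hp1 : ∑ k, (p k).toReal = 1 := by
    rw [← ENNReal.toReal_sum fun k _ => p.apply_ne_top k,
      ← tsum_fintype (L := .unconditional _) (f := fun k => p k), PMF.tsum_coe, ENNReal.toReal_one]
  have hexp : ∀ k, Real.exp (s * x k) ≤ 1 + s * x k + (s * β) ^ 2 := by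
    intro k
    have hk : |s * x k| ≤ s * β := by
      rw [abs_mul, abs_of_pos hs0]
      exact mul_le_mul_of_nonneg_left (hx k) hs0.le
    have h1 := Real.abs_exp_sub_one_sub_id_le (hk.trans hsβ)
    have h2 := (abs_le.mp h1).2
    have h3 : (s * x k) ^ 2 ≤ (s * β) ^ 2 := sq_le_sq' (by linarith [(abs_le.mp hk).1])
      (abs_le.mp hk).2
    linarith
  have hmgf : ∑ k, p k * ENNReal.ofReal (Real.exp (s * x k)) ≤
      ENNReal.ofReal (Real.exp ((s * β) ^ 2)) := by
    have h1 : ∀ k, p k * ENNReal.ofReal (Real.exp (s * x k)) =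
        ENNReal.ofReal ((p k).toReal * Real.exp (s * x k)) := by
      intro k
      rw [ENNReal.ofReal_mul ENNReal.toReal_nonneg, ENNReal.ofReal_toReal (p.apply_ne_top k)]
    simp_rw [h1]
    rw [← ENNReal.ofReal_sum_of_nonneg fun k _ => by positivity]
    refine ENNReal.ofReal_le_ofReal ?_
    calc ∑ k, (p k).toReal * Real.exp (s * x k)
        ≤ ∑ k, (p k).toReal * (1 + s * x k + (s * β) ^ 2) := by
          refine Finset.sum_le_sum fun k _ => ?_
          exact mul_le_mul_of_nonneg_left (hexp k) ENNReal.toReal_nonneg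
      _ = (1 + (s * β) ^ 2) * ∑ k, (p k).toReal + s * ∑ k, (p k).toReal * x k := by
          rw [Finset.mul_sum, Finset.mul_sum, ← Finset.sum_add_distrib]
          exact Finset.sum_congr rfl fun k _ => by ring
      _ ≤ _ := by
          rw [hp1, hmean, mul_one, mul_zero, add_zero, add_comm]
          exact Real.add_one_le_exp _
  have hmarkov := iid_markov p r (fun k => ENNReal.ofReal (Real.exp (s * x k)))
    (ENNReal.ofReal (Real.exp (s * (η * r))))
  have hsub : {f : Fin r → K | η * r ≤ ∑ i, x (f i)} ⊆
      {f | ENNReal.ofReal (Real.exp (s * (η * r))) ≤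
        ∏ i, ENNReal.ofReal (Real.exp (s * x (f i)))} := by
    intro f hf
    have hf : η * r ≤ ∑ i, x (f i) := hf
    show _ ≤ ∏ i, ENNReal.ofReal (Real.exp (s * x (f i)))
    rw [← ENNReal.ofReal_prod_of_nonneg fun i _ => (Real.exp_pos _).le, ← Real.exp_sum,
      ← Finset.mul_sum]
    gcongr
  refine ((iid p r).toOuterMeasure.mono hsub).trans ?_
  have h5 := hmarkov.trans (pow_le_pow_left₀ zero_le hmgf r)
  rw [← ENNReal.le_div_iff_mul_le (Or.inl (by simp [Real.exp_pos])) (Or.inl ENNReal.ofReal_ne_top),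
    ← ENNReal.ofReal_pow (Real.exp_pos _).le, ← ENNReal.ofReal_div_of_pos (Real.exp_pos _),
    ← Real.exp_nat_mul, ← Real.exp_sub] at h5
  refine h5.trans (le_of_eq ?_)
  congr 2
  rw [hs]
  field_simp
  ring

theorem iid_tail_abs {K : Type} [Fintype K] (p : PMF K) (r : ℕ) (x : K → ℝ) {β η : ℝ}
    (hβ : 1 ≤ β) (hη : 0 < η) (hη1 : η ≤ 1) (hx : ∀ k, |x k| ≤ β)
    (hmean : ∑ k, (p k).toReal * x k = 0) :
    (iid p r).toOuterMeasure {f | ¬ |∑ i, x (f i)| ≤ η * r} ≤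
      2 * ENNReal.ofReal (Real.exp (-(r * η ^ 2 / (4 * β ^ 2)))) := by
  have h1 := iid_tail p r x hβ hη hη1 hx hmean
  have h2 := iid_tail p r (fun k => -x k) hβ hη hη1 (fun k => by rw [abs_neg]; exact hx k)
    (by simp [hmean])
  have hsub : {f : Fin r → K | ¬ |∑ i, x (f i)| ≤ η * r} ⊆
      {f | η * r ≤ ∑ i, x (f i)} ∪ {f | η * r ≤ ∑ i, -x (f i)} := by
    intro f hf
    have hf : ¬ |∑ i, x (f i)| ≤ η * r := hf
    rw [not_le, lt_abs] at hf
    rcases hf with hf | hf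
    · exact Or.inl hf.le
    · refine Or.inr ?_
      show η * r ≤ ∑ i, -x (f i)
      rw [Finset.sum_neg_distrib]
      exact hf.le
  refine (MeasureTheory.measure_mono hsub).trans ((MeasureTheory.measure_union_le _ _).trans ?_)
  rw [two_mul]
  exact add_le_add h1 h2

/-! ### Coarse size estimates by random subsampling of the coordinates -/

/-- A hash function for each of the `d` coordinates, with `ℓ`-bit values. -/
abbrev Hash (d n ℓ : ℕ) : Type := Fin d → Fin n → Fin (2 ^ ℓ)

/-- Some point of `S` survives when in the `i`-th coordinate only the vertices with hash value
below `2 ^ (ℓ - q i)` are kept. -/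
def Hits {d n ℓ : ℕ} (S : Finset (Fin d → Fin n)) (h : Hash d n ℓ) (q : Fin d → ℕ) : Prop :=
  ∃ x ∈ S, ∀ i, (h i (x i) : ℕ) < 2 ^ (ℓ - q i)

theorem card_fin_lt {N k : ℕ} (hk : k ≤ N) :
    (Finset.univ.filter fun a : Fin N => (a : ℕ) < k).card = k := by
  rw [Fin.card_filter_val_lt, min_eq_right hk]

open Classical in
-- Survival of `x` restricts just one hash value per coordinate, to a 2^(-q i) fraction of its
-- range, and these restrictions are independent.
theorem card_survive {d n ℓ : ℕ} (x : Fin d → Fin n) (q : Fin d → ℕ) (hq : ∀ i, q i ≤ ℓ) :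
    (Finset.univ.filter fun h : Hash d n ℓ => ∀ i, (h i (x i) : ℕ) < 2 ^ (ℓ - q i)).card *
      2 ^ ∑ i, q i = Fintype.card (Hash d n ℓ) := by
  have h1 : (Finset.univ.filter fun h : Hash d n ℓ => ∀ i, (h i (x i) : ℕ) < 2 ^ (ℓ - q i)) =
      Fintype.piFinset fun i => Fintype.piFinset fun v =>
        if v = x i then Finset.univ.filter fun a : Fin (2 ^ ℓ) => (a : ℕ) < 2 ^ (ℓ - q i)
        else Finset.univ := by
    ext h
    simp only [Finset.mem_filter, Finset.mem_univ, true_and, Fintype.mem_piFinset]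
    refine forall_congr' fun i => ⟨fun hi v => ?_, fun hi => ?_⟩
    · split_ifs with hv
      · subst hv; simpa using hi
      · simp
    · simpa using hi (x i)
  rw [h1, Fintype.card_piFinset, ← Finset.prod_pow_eq_pow_sum, ← Finset.prod_mul_distrib,
    Fintype.card_pi]
  refine Finset.prod_congr rfl fun i _ => ?_
  have h2 : ∏ v : Fin n, (if v = x i then 2 ^ q i else 1) = 2 ^ q i := by
    rw [Finset.prod_ite_eq', if_pos (Finset.mem_univ _)]
  rw [Fintype.card_piFinset, Fintype.card_pi, ← h2, ← Finset.prod_mul_distrib]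
  refine Finset.prod_congr rfl fun v _ => ?_
  split_ifs
  · rw [card_fin_lt (Nat.pow_le_pow_right two_pos (Nat.sub_le _ _)), ← pow_add,
      Nat.sub_add_cancel (hq i), Fintype.card_fin]
  · simp

open Classical in
/-- Few choices of the hash functions keep a point of a small set. -/
theorem card_hits_le {d n ℓ : ℕ} (S : Finset (Fin d → Fin n)) (q : Fin d → ℕ)
    (hq : ∀ i, q i ≤ ℓ) :
    (Finset.univ.filter fun h : Hash d n ℓ => Hits S h q).card * 2 ^ ∑ i, q i ≤
      S.card * Fintype.card (Hash d n ℓ) := by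
  have h1 : (Finset.univ.filter fun h : Hash d n ℓ => Hits S h q) ⊆
      S.biUnion fun x => Finset.univ.filter fun h : Hash d n ℓ =>
        ∀ i, (h i (x i) : ℕ) < 2 ^ (ℓ - q i) := by
    intro h hh
    simpa [Hits] using (Finset.mem_filter.mp hh).2
  calc _ ≤ (∑ x ∈ S, (Finset.univ.filter fun h : Hash d n ℓ =>
        ∀ i, (h i (x i) : ℕ) < 2 ^ (ℓ - q i)).card) * 2 ^ ∑ i, q i :=
        Nat.mul_le_mul_right _ ((Finset.card_le_card h1).trans Finset.card_biUnion_le)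
    _ = S.card * Fintype.card (Hash d n ℓ) := by
        rw [Finset.sum_mul, Finset.sum_congr rfl fun x _ => card_survive x q hq,
          Finset.sum_const, smul_eq_mul]

/-- Bernoulli gives k p ≤ (1 + p)^k, and (1 - p)(1 + p) ≤ 1. It bounds by 1 / (k p) the probability
that none of `k` elements is kept. -/
theorem pow_one_sub_mul_le {p : ℝ} (hp : 0 ≤ p) (hp1 : p ≤ 1) (k : ℕ) :
    (1 - p) ^ k * (k * p) ≤ 1 := by
  have h1 : 1 + (k : ℝ) * p ≤ (1 + p) ^ k := one_add_mul_le_pow (by linarith) k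
  have h2 : 0 ≤ (1 - p) ^ k := pow_nonneg (by linarith) k
  calc (1 - p) ^ k * (k * p) ≤ (1 - p) ^ k * (1 + p) ^ k :=
        mul_le_mul_of_nonneg_left (by linarith) h2
    _ = ((1 - p) * (1 + p)) ^ k := (mul_pow _ _ _).symm
    _ ≤ 1 := pow_le_one₀ (mul_nonneg (by linarith) (by linarith)) (by nlinarith)

open Classical in
/-- Few hash functions discard all elements of a large set. -/
theorem card_miss_le {n ℓ τ q : ℕ} (T : Finset (Fin n)) (hq : q ≤ ℓ)
    (hT : 2 ^ τ * 2 ^ q ≤ T.card) :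
    2 ^ τ * (Finset.univ.filter fun g : Fin n → Fin (2 ^ ℓ) =>
      ∀ v ∈ T, ¬ (g v : ℕ) < 2 ^ (ℓ - q)).card ≤ Fintype.card (Fin n → Fin (2 ^ ℓ)) := by
  have h1 : (Finset.univ.filter fun g : Fin n → Fin (2 ^ ℓ) =>
      ∀ v ∈ T, ¬ (g v : ℕ) < 2 ^ (ℓ - q)) =
      Fintype.piFinset fun v => if v ∈ T then
        Finset.univ.filter fun a : Fin (2 ^ ℓ) => ¬ (a : ℕ) < 2 ^ (ℓ - q) else Finset.univ := by
    ext g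
    simp only [Finset.mem_filter, Finset.mem_univ, true_and, Fintype.mem_piFinset]
    refine forall_congr' fun v => ?_
    split_ifs with hv <;> simp [hv]
  have h2 : ((Finset.univ.filter fun a : Fin (2 ^ ℓ) => ¬ (a : ℕ) < 2 ^ (ℓ - q)).card : ℝ) =
      2 ^ ℓ * (1 - (2 ^ q)⁻¹) := by
    have h3 := Finset.card_filter_add_card_filter_not (s := (Finset.univ : Finset (Fin (2 ^ ℓ))))
      (fun a : Fin (2 ^ ℓ) => (a : ℕ) < 2 ^ (ℓ - q))
    rw [card_fin_lt (Nat.pow_le_pow_right two_pos (Nat.sub_le _ _)), Finset.card_univ,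
      Fintype.card_fin] at h3
    have h4 : ((2 : ℝ) ^ (ℓ - q)) = 2 ^ ℓ * (2 ^ q)⁻¹ := pow_sub₀ _ two_ne_zero hq
    have h5 : ((2 : ℝ) ^ (ℓ - q)) +
      ((Finset.univ.filter fun a : Fin (2 ^ ℓ) => ¬ (a : ℕ) < 2 ^ (ℓ - q)).card : ℝ) = 2 ^ ℓ := by
      exact_mod_cast h3
    rw [mul_sub, mul_one, ← h4]
    linarith
  rw [h1, Fintype.card_piFinset, Fintype.card_pi]
  have h6 : (2 : ℝ) ^ τ * ∏ v, ((if v ∈ T then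
        Finset.univ.filter fun a : Fin (2 ^ ℓ) => ¬ (a : ℕ) < 2 ^ (ℓ - q)
        else Finset.univ).card : ℝ) ≤ ∏ _v : Fin n, ((2 : ℝ) ^ ℓ) := by
    have h7 : ∀ v, ((if v ∈ T then
        Finset.univ.filter fun a : Fin (2 ^ ℓ) => ¬ (a : ℕ) < 2 ^ (ℓ - q)
        else Finset.univ).card : ℝ) = 2 ^ ℓ * (if v ∈ T then 1 - ((2 : ℝ) ^ q)⁻¹ else 1) := by
      intro v
      split_ifs with hv
      · exact h2
      · simp
    rw [Finset.prod_congr rfl fun v _ => h7 v, Finset.prod_mul_distrib, mul_left_comm]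
    refine mul_le_of_le_one_right (by positivity) ?_
    rw [Finset.prod_ite_mem, Finset.univ_inter, Finset.prod_const]
    have hp1 : ((2 : ℝ) ^ q)⁻¹ ≤ 1 := inv_le_one_of_one_le₀ (one_le_pow₀ one_le_two)
    refine le_trans ?_ (pow_one_sub_mul_le (p := ((2 : ℝ) ^ q)⁻¹) (by positivity) hp1 T.card)
    rw [mul_comm]
    refine mul_le_mul_of_nonneg_left ?_ (pow_nonneg (by linarith) _)
    rw [← div_eq_mul_inv, le_div_iff₀ (by positivity)]
    exact_mod_cast hT
  simp only [Fintype.card_fin]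
  exact_mod_cast h6

open Classical in
/-- A popular value of a bounded function. -/
theorem exists_popular {α : Type} (S : Finset α) (f : α → ℕ) (k : ℕ)
    (hf : ∀ x ∈ S, f x ≤ k) :
    ∃ j ≤ k, S.card ≤ (k + 1) * (S.filter fun x => f x = j).card := by
  by_contra! hcon
  have h1 := Finset.card_eq_sum_card_fiberwise (s := S) (t := Finset.range (k + 1)) (f := f)
    (fun x hx => by simpa [Nat.lt_succ_iff] using hf x hx)
  have h2 : ∑ j ∈ Finset.range (k + 1), (k + 1) * (S.filter fun x => f x = j).card <
      ∑ j ∈ Finset.range (k + 1), S.card :=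
    Finset.sum_lt_sum_of_nonempty (by simp) fun j hj =>
      hcon j (by simpa [Nat.lt_succ_iff] using hj)
  rw [← Finset.mul_sum, ← h1, Finset.sum_const, Finset.card_range, smul_eq_mul] at h2
  exact lt_irrefl _ h2

open Classical in
/-- At a suitable scale, close to the size of `S`, most hash functions keep a point of `S`. -/
theorem exists_scale {n ℓ : ℕ} (hn : n ≤ 2 ^ ℓ) (τ : ℕ) {d : ℕ} (S : Finset (Fin d → Fin n))
    (hS : S.Nonempty) :
    ∃ q : Fin d → ℕ, (∀ i, q i ≤ ℓ) ∧
      S.card ≤ ((ℓ + 1) * 2 ^ (τ + 1)) ^ d * 2 ^ ∑ i, q i ∧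
      2 ^ τ * (Finset.univ.filter fun h : Hash d n ℓ => ¬ Hits S h q).card ≤
        d * Fintype.card (Hash d n ℓ) := by
  induction d with
  | zero =>
    refine ⟨fun i => i.elim0, fun i => i.elim0, ?_, ?_⟩
    · simpa using Finset.card_le_univ S
    · obtain ⟨x, hx⟩ := hS
      have : ∀ h : Hash 0 n ℓ, Hits S h fun i => i.elim0 := fun h => ⟨x, hx, fun i => i.elim0⟩
      simp [this]
  | succ d ih =>
    set fiber : (Fin d → Fin n) → Finset (Fin n) :=
      fun y => Finset.univ.filter fun v => (Fin.cons v y : Fin (d + 1) → Fin n) ∈ S with hfiber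
    have hfib : ∀ y, (fiber y).card ≤ 2 ^ ℓ := fun y =>
      (Finset.card_le_univ _).trans (by simpa using hn)
    -- Some dyadic class of fibre sizes in coordinate 0 contains at least a 1 / (ℓ + 1) fraction of
    -- `S`. The induction hypothesis is applied to the projection of that class.
    obtain ⟨j, hj, hpop⟩ := exists_popular S
      (fun x => Nat.log 2 (fiber (Fin.tail x)).card) ℓ fun x _ =>
        (Nat.log_mono_right (hfib _)).trans (Nat.log_pow one_lt_two ℓ).le
    set S₁ := S.filter fun x => Nat.log 2 (fiber (Fin.tail x)).card = j with hS₁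
    have hS₁ne : S₁.Nonempty := by
      rw [← Finset.card_pos]
      have := hS.card_pos
      by_contra! h
      rw [Nat.le_zero.mp h, mul_zero] at hpop
      omega
    set P := S₁.image Fin.tail with hP
    have hPfib : ∀ y ∈ P, 2 ^ j ≤ (fiber y).card ∧ (fiber y).card < 2 ^ (j + 1) := by
      intro y hy
      obtain ⟨x, hx, rfl⟩ := Finset.mem_image.mp hy
      obtain ⟨hxS, hxj⟩ := Finset.mem_filter.mp hx
      have hne : (fiber (Fin.tail x)).card ≠ 0 := by
        refine (Finset.card_pos.mpr ⟨x 0, ?_⟩).ne'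
        simpa [hfiber] using hxS
      rw [← hxj]
      exact ⟨Nat.pow_log_le_self 2 hne, Nat.lt_pow_succ_log_self one_lt_two _⟩
    obtain ⟨q, hq, hcard, hmiss⟩ := ih P (hS₁ne.image _)
    have hS₁card : S₁.card ≤ 2 ^ (j + 1) * P.card := by
      refine Finset.card_le_mul_card_image _ _ fun y hy => ?_
      refine le_trans ?_ (hPfib y hy).2.le
      refine Finset.card_le_card_of_injOn (fun x => x 0) ?_ ?_
      · intro x hx
        obtain ⟨hx, rfl⟩ := Finset.mem_filter.mp hx
        simpa [hfiber] using (Finset.mem_filter.mp (Finset.mem_filter.mp hx).1).1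
      · intro x hx x' hx' hxx
        have h1 := (Finset.mem_filter.mp hx).2
        have h2 := (Finset.mem_filter.mp hx').2
        rw [← Fin.cons_self_tail x, ← Fin.cons_self_tail x', h1, h2]
        congr 1
    have hone : ∀ y ∈ P, 2 ^ τ * (Finset.univ.filter fun g : Fin n → Fin (2 ^ ℓ) =>
        ∀ v ∈ fiber y, ¬ (g v : ℕ) < 2 ^ (ℓ - (j - τ))).card ≤
          Fintype.card (Fin n → Fin (2 ^ ℓ)) := by
      intro y hy
      rcases le_total τ j with hτ | hτ
      · refine card_miss_le _ (by omega) ?_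
        rw [← pow_add, Nat.add_sub_cancel' hτ]
        exact (hPfib y hy).1
      · obtain ⟨v, hv⟩ := Finset.card_pos.mp (lt_of_lt_of_le (by positivity) (hPfib y hy).1)
        rw [Finset.filter_false_of_mem]
        · simp
        · intro g _ hg
          refine hg v hv ?_
          rw [Nat.sub_eq_zero_of_le hτ]
          exact (g v).2
    -- A fibre of at least 2^j points, thinned by 2^(j - τ), keeps about 2^τ of them or more, hence
    -- is missed with probability at most 2^(-τ). If j ≤ τ the truncated difference is 0 and nothing
    -- is discarded.
    refine ⟨Fin.cons (j - τ) q, ?_, ?_, ?_⟩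
    · intro i
      refine Fin.cases ?_ (fun i => ?_) i
      · simp only [Fin.cons_zero]; omega
      · simpa using hq i
    · rw [Fin.sum_univ_succ]
      simp only [Fin.cons_zero, Fin.cons_succ]
      have hj2 : 2 ^ (j + 1) ≤ 2 ^ (τ + 1) * 2 ^ (j - τ) := by
        rw [← pow_add]
        exact Nat.pow_le_pow_right two_pos (by omega)
      calc S.card ≤ (ℓ + 1) * (2 ^ (j + 1) * P.card) := hpop.trans (Nat.mul_le_mul_left _ hS₁card)
        _ ≤ (ℓ + 1) * ((2 ^ (τ + 1) * 2 ^ (j - τ)) *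
            (((ℓ + 1) * 2 ^ (τ + 1)) ^ d * 2 ^ ∑ i, q i)) := by gcongr
        _ = _ := by rw [pow_add 2 (j - τ)]; ring
    · set Ω := Fintype.card (Fin n → Fin (2 ^ ℓ)) with hΩ
      have hcardΩ : Fintype.card (Hash (d + 1) n ℓ) = Ω * Fintype.card (Hash d n ℓ) := by
        simp [hΩ, Hash, pow_succ, mul_comm]
      -- Condition on the hash functions of the other coordinates. If they keep some y in `P`, only
      -- the hash function of coordinate 0 can fail, by missing the fibre over y; otherwise
      -- everything is counted as a failure, which the induction hypothesis makes rare.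
      have hfibcard : ∀ h' : Hash d n ℓ,
          2 ^ τ * ((Finset.univ.filter fun h : Hash (d + 1) n ℓ =>
            ¬ Hits S h (Fin.cons (j - τ) q)).filter fun h => Fin.tail h = h').card ≤
          Ω + if Hits P h' q then 0 else 2 ^ τ * Ω := by
        intro h'
        have hinj : ∀ B : Finset (Hash (d + 1) n ℓ),
            Set.InjOn (fun h : Hash (d + 1) n ℓ => h 0)
              (B.filter fun h => Fin.tail h = h' : Finset _) := by
          intro B h₁ hh₁ h₂ hh₂ h12
          have e1 := (Finset.mem_filter.mp hh₁).2
          have e2 := (Finset.mem_filter.mp hh₂).2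
          rw [← Fin.cons_self_tail h₁, ← Fin.cons_self_tail h₂, e1, e2]
          congr 1
        split_ifs with hh
        · obtain ⟨y, hy, hkept⟩ := hh
          rw [add_zero]
          refine le_trans (Nat.mul_le_mul_left _ ?_) (hone y hy)
          refine Finset.card_le_card_of_injOn (fun h => h 0) ?_ (hinj _)
          intro h hh
          obtain ⟨hmem, rfl⟩ := Finset.mem_filter.mp hh
          have hnot := (Finset.mem_filter.mp hmem).2
          refine Finset.mem_filter.mpr ⟨Finset.mem_univ _, fun v hv hlt => hnot ?_⟩
          refine ⟨Fin.cons v y, (Finset.mem_filter.mp hv).2, fun i => ?_⟩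
          refine Fin.cases ?_ (fun i => ?_) i
          · simpa using hlt
          · simpa [Fin.tail] using hkept i
        · refine le_add_left (Nat.mul_le_mul_left _ ?_)
          exact Finset.card_le_card_of_injOn (fun h => h 0) (fun _ _ => Finset.mem_univ _) (hinj _)
      rw [Finset.card_eq_sum_card_fiberwise (f := Fin.tail) (t := Finset.univ)
        (fun _ _ => Finset.mem_univ _), Finset.mul_sum]
      refine (Finset.sum_le_sum fun h' _ => hfibcard h').trans ?_
      rw [Finset.sum_add_distrib, Finset.sum_const, smul_eq_mul, Finset.card_univ, hcardΩ,
        Finset.sum_ite, Finset.sum_const_zero, zero_add, Finset.sum_const, smul_eq_mul]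
      nlinarith [Nat.mul_le_mul_left Ω hmiss]

/-- The largest scale at which the majority of the trials answers *yes*. -/
def scale {d r ℓ : ℕ} (ans : Fin r → (Fin d → Fin (ℓ + 1)) → Bool) : ℕ :=
  (Finset.univ.filter fun q => r < 2 * (Finset.univ.filter fun i => ans i q = true).card).sup
    fun q => 2 ^ ∑ i, (q i : ℕ)

open Classical in
/-- The estimate of the size of `S` that the trials with hash functions `G` lead to. -/
noncomputable def estimate {d n ℓ r : ℕ} (S : Finset (Fin d → Fin n))
    (G : Fin r → Hash d n ℓ) : ℕ :=
  scale fun i (q : Fin d → Fin (ℓ + 1)) => decide (Hits S (G i) fun j => (q j : ℕ))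

/-- The factor by which the estimate may be too small. -/
def loss (d ℓ : ℕ) : ℕ := ((ℓ + 1) * 2 ^ (d + 5)) ^ d

theorem estimate_empty {d n ℓ r : ℕ} (G : Fin r → Hash d n ℓ) :
    estimate (∅ : Finset (Fin d → Fin n)) G = 0 := by
  simp [estimate, scale, Hits]

instance {d n ℓ : ℕ} : Nonempty (Hash d n ℓ) := ⟨fun _ _ => ⟨0, by positivity⟩⟩

open Classical in
-- Outside a union of two majority failures for each of the (ℓ + 1)^d scales, a majority of yes
-- answers means a hit probability above 1/16, hence 2^(∑ q i) ≤ 16 |S| by `card_hits_le`, while the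
-- scale of `exists_scale` does get a majority.
theorem estimate_fails {d n ℓ : ℕ} (hn : n ≤ 2 ^ ℓ) (r : ℕ) (S : Finset (Fin d → Fin n)) :
    (iid (PMF.uniformOfFintype (Hash d n ℓ)) r).toOuterMeasure
      {G | ¬ (S.card ≤ loss d ℓ * estimate S G ∧ estimate S G ≤ 16 * S.card)} ≤
      2 * ((ℓ + 1) ^ d : ℕ) * 2⁻¹ ^ r := by
  set Q := Fin d → Fin (ℓ + 1)
  set yes : Q → Set (Hash d n ℓ) := fun q => {h | Hits S h fun j => (q j : ℕ)} with hyes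
  set unlikely : Set (Hash d n ℓ) → Prop := fun B =>
    (PMF.uniformOfFintype (Hash d n ℓ)).toOuterMeasure B * 16 ≤ 1 with hunlikely
  have hunl : ∀ p : Hash d n ℓ → Prop,
      16 * (Finset.univ.filter p).card ≤ Fintype.card (Hash d n ℓ) → unlikely {h | p h} := by
    intro p hp
    simp only [hunlikely]
    rw [PMF.toOuterMeasure_uniformOfFintype_apply, Fintype.card_subtype, mul_comm, ← mul_div_assoc]
    refine ENNReal.div_le_of_le_mul ?_
    rw [one_mul]
    exact_mod_cast hp
  set many : Set (Hash d n ℓ) → Set (Fin r → Hash d n ℓ) := fun B =>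
    {G | r ≤ 2 * (Finset.univ.filter fun i => G i ∈ B).card} with hmany
  have hmaj : ∀ B, unlikely B → (iid (PMF.uniformOfFintype (Hash d n ℓ)) r).toOuterMeasure
      (many B) ≤ 2⁻¹ ^ r := fun B hB => iid_majority _ r B hB
  -- With unlikeliness built in, the event is empty for likely `B`, so one bound covers every scale.
  set rare : Set (Hash d n ℓ) → Set (Fin r → Hash d n ℓ) := fun B =>
    {G | unlikely B ∧ G ∈ many B} with hrare
  have hrarele : ∀ B, (iid (PMF.uniformOfFintype (Hash d n ℓ)) r).toOuterMeasure (rare B) ≤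
      2⁻¹ ^ r := by
    intro B
    by_cases hB : unlikely B
    · exact (MeasureTheory.measure_mono fun G hG => hG.2).trans (hmaj B hB)
    · simp [hrare, hB]
  have hEle : ∀ q, (iid (PMF.uniformOfFintype (Hash d n ℓ)) r).toOuterMeasure
      (rare (yes q) ∪ rare (yes q)ᶜ) ≤ 2 * 2⁻¹ ^ r := fun q => by
    rw [two_mul]
    exact (MeasureTheory.measure_union_le _ _).trans (add_le_add (hrarele _) (hrarele _))
  have hsub : {G : Fin r → Hash d n ℓ |
      ¬ (S.card ≤ loss d ℓ * estimate S G ∧ estimate S G ≤ 16 * S.card)} ⊆ ⋃ q, (rare (yes q) ∪ rare (yes q)ᶜ) := by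
    intro G hG
    by_contra hnot
    simp only [Set.mem_iUnion, not_exists, Set.mem_union, not_or] at hnot
    refine hG ⟨?_, ?_⟩
    · rcases S.eq_empty_or_nonempty with rfl | hS
      · simp
      -- With τ = d + 4 the miss probability is at most d / 2^(d+4) ≤ 1/16, and the factor becomes
      -- exactly `loss d ℓ`.
      obtain ⟨q, hq, hcard, hmiss⟩ := exists_scale hn (d + 4) S hS
      set q' : Q := fun i => ⟨q i, Nat.lt_succ_of_le (hq i)⟩ with hq'
      have hno : unlikely (yes q')ᶜ := by
        refine hunl (fun h => ¬ Hits S h q) ?_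
        have hd : d < 2 ^ d := Nat.lt_two_pow_self
        refine Nat.le_of_mul_le_mul_left (c := 2 ^ d) ?_ (Nat.two_pow_pos d)
        calc _ = 2 ^ (d + 4) * (Finset.univ.filter fun h : Hash d n ℓ => ¬ Hits S h q).card := by
              rw [pow_add, mul_assoc]; congr!
          _ ≤ _ := hmiss.trans (Nat.mul_le_mul_right _ hd.le)
      have hmost : r < 2 * (Finset.univ.filter fun i => G i ∈ yes q').card := by
        have h1 : ¬ r ≤ 2 * (Finset.univ.filter fun i => ¬ G i ∈ yes q').card := fun h =>
          (hnot q').2 ⟨hno, by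
            simp only [hmany, Set.mem_ofPred_eq]
            convert h⟩
        have h2 := Finset.card_filter_add_card_filter_not (s := (Finset.univ : Finset (Fin r)))
          (fun i => G i ∈ yes q')
        rw [Finset.card_univ, Fintype.card_fin] at h2
        omega
      have hest : 2 ^ ∑ i, q i ≤ estimate S G := by
        refine Finset.le_sup (f := fun q : Q => 2 ^ ∑ i, (q i : ℕ)) (b := q')
          (Finset.mem_filter.mpr ⟨Finset.mem_univ _, ?_⟩)
        simpa [hyes] using hmost
      exact hcard.trans (Nat.mul_le_mul_left _ hest)
    · refine Finset.sup_le fun q hq => ?_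
      have hq : r < 2 * (Finset.univ.filter fun i => G i ∈ yes q).card := by
        simpa [hyes] using (Finset.mem_filter.mp hq).2
      have hlikely : ¬ unlikely (yes q) := fun h => (hnot q).1 ⟨h, hq.le⟩
      have hcard : Fintype.card (Hash d n ℓ) ≤
          16 * (Finset.univ.filter fun h : Hash d n ℓ => Hits S h fun j => (q j : ℕ)).card := by
        by_contra! h
        exact hlikely (hunl _ h.le)
      have hhits := card_hits_le S (fun j => (q j : ℕ)) fun j => Nat.le_of_lt_succ (q j).2
      refine Nat.le_of_mul_le_mul_left (c := Fintype.card (Hash d n ℓ)) ?_ Fintype.card_pos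
      calc _ ≤ _ := Nat.mul_le_mul_right _ hcard
        _ ≤ 16 * (S.card * Fintype.card (Hash d n ℓ)) := by
            rw [mul_assoc]; exact Nat.mul_le_mul_left _ hhits
        _ = _ := by ring
  calc _ ≤ (iid (PMF.uniformOfFintype (Hash d n ℓ)) r).toOuterMeasure (⋃ q, (rare (yes q) ∪ rare (yes q)ᶜ)) :=
        MeasureTheory.measure_mono hsub
    _ ≤ ∑ q, (iid (PMF.uniformOfFintype (Hash d n ℓ)) r).toOuterMeasure (rare (yes q) ∪ rare (yes q)ᶜ) :=
        MeasureTheory.measure_iUnion_fintype_le _ _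
    _ ≤ ∑ q : Q, 2 * 2⁻¹ ^ r := Finset.sum_le_sum fun q _ => hEle q
    _ = _ := by simp [Q]; ring

/-! ### Importance sampling -/

/-- The distribution with probabilities proportional to `w j * e j`. -/
noncomputable def weightPMF {J : Type} [Fintype J] (w : J → ℝ≥0) (e : J → ℕ)
    (h : ∑ j, w j * e j ≠ 0) : PMF J :=
  PMF.ofFintype (fun j => ((w j * e j / ∑ j, w j * e j : ℝ≥0) : ℝ≥0∞)) (by
    rw [← ENNReal.ofNNReal_finsetSum, ← Finset.sum_div, div_self h, ENNReal.coe_one])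

/-- Importance sampling: draw `L` indices with probabilities proportional to `w j * e j`, and
reweight them. -/
noncomputable def resample {Q : Type u} {J A : Type} [Fintype J] [Inhabited A] (L : ℕ) (a : J → A)
    (w : J → ℝ≥0) (e : J → ℕ) : RandAlg Q (Fin L → A × ℝ≥0) :=
  open Classical in
  if h : ∑ j, w j * e j ≠ 0 then
    (draw (iid (weightPMF w e h) L)).bind fun f =>
      .output fun i => (a (f i), (∑ j, w j * e j) / (L * e (f i)))
  -- If every `w j * e j` vanishes, the true weighted total vanishes as well when each count is at
  -- most a multiple of its estimate, so weight 0 is exact.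
  else .output fun _ => (default, 0)

/-- Let W and T be the estimated and true weighted totals. The normalised term W m_j / (e_j T) has
mean 1, and it lies between 0 and 16 b because W ≤ 16 T and m_j ≤ b e_j. So `iid_tail_abs` applies
with β = 16 b. -/
theorem iid_weightPMF {J : Type} [Fintype J] {w : J → ℝ≥0} {m e : J → ℕ} {b L : ℕ} {η : ℝ}
    (hb : 1 ≤ b) (hm : ∀ j, m j ≤ b * e j) (he : ∀ j, e j ≤ 16 * m j) (hL : 0 < L) (hη : 0 < η)
    (hη1 : η ≤ 1) (h : ∑ j, w j * e j ≠ 0) :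
    (iid (weightPMF w e h) L).toOuterMeasure
      {f | ¬ |∑ i, (((∑ j, w j * e j) / (L * e (f i)) : ℝ≥0) : ℝ) * m (f i) - ∑ j, (w j : ℝ) * m j| ≤
        η * ∑ j, (w j : ℝ) * m j} ≤
      2 * ENNReal.ofReal (Real.exp (-(L * η ^ 2 / (4 * (16 * b : ℝ) ^ 2)))) := by
  set W : ℝ≥0 := ∑ j, w j * e j with hW
  set T : ℝ := ∑ j, (w j : ℝ) * m j with hT
  have hW0 : 0 < (W : ℝ) := by positivity
  have hWsum : (W : ℝ) = ∑ j, (w j : ℝ) * e j := by simp [hW]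
  have hWT : (W : ℝ) ≤ 16 * T := by
    rw [hWsum, hT, Finset.mul_sum]
    refine Finset.sum_le_sum fun j _ => ?_
    have : (e j : ℝ) ≤ 16 * m j := by exact_mod_cast he j
    nlinarith [(w j).coe_nonneg]
  have hT0 : 0 < T := by linarith
  have hb' : (1 : ℝ) ≤ b := by exact_mod_cast hb
  have hL' : (0 : ℝ) < L := by exact_mod_cast hL
  set x : J → ℝ := fun j => W * m j / (e j * T) - 1 with hx
  have hxbound : ∀ j, |x j| ≤ 16 * b := by
    intro j
    have h0 : 0 ≤ W * m j / (e j * T) := by positivity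
    have h1 : W * m j / (e j * T) ≤ 16 * b := by
      rcases Nat.eq_zero_or_pos (e j) with h2 | h2
      · rw [h2, Nat.cast_zero, zero_mul, div_zero]; positivity
      · have h2' : (0 : ℝ) < e j := by exact_mod_cast h2
        rw [div_le_iff₀ (by positivity)]
        have h3 : (m j : ℝ) ≤ b * e j := by exact_mod_cast hm j
        calc (W : ℝ) * m j ≤ (16 * T) * (b * e j) := by gcongr
          _ = _ := by ring
    rw [abs_le]
    constructor <;> simp only [hx] <;> linarith
  have hmean : ∑ j, ((weightPMF w e h) j).toReal * x j = 0 := by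
    have h1 : ∀ j, ((weightPMF w e h) j).toReal * x j = (w j * m j) / T - (w j * e j) / W := by
      intro j
      simp only [weightPMF, PMF.ofFintype_apply, ENNReal.coe_toReal, ← hW, hx, NNReal.coe_div,
        NNReal.coe_mul, NNReal.coe_natCast]
      -- A zero estimate forces a zero count, so division by `e j = 0` loses nothing.
      rcases Nat.eq_zero_or_pos (e j) with h2 | h2
      · have h3 : m j = 0 := by have := hm j; rw [h2] at this; omega
        simp [h2, h3]
      · have h2' : (0 : ℝ) < e j := by exact_mod_cast h2
        field_simp
    rw [Finset.sum_congr rfl fun j _ => h1 j, Finset.sum_sub_distrib, ← Finset.sum_div,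
      ← Finset.sum_div, ← hT, ← hWsum, div_self hT0.ne', div_self hW0.ne', sub_self]
  refine (MeasureTheory.measure_mono ?_).trans
    (iid_tail_abs (weightPMF w e h) L x (by linarith) hη hη1 hxbound hmean)
  intro f hf hf'
  refine hf ?_
  have h2 : ∑ i, ((W / (L * e (f i)) : ℝ≥0) : ℝ) * m (f i) - T = T / L * ∑ i, x (f i) := by
    simp only [hx]
    rw [Finset.sum_sub_distrib, Finset.sum_const, Finset.card_univ, Fintype.card_fin, nsmul_eq_mul,
      mul_one, mul_sub, div_mul_cancel₀ _ hL'.ne', Finset.mul_sum]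
    congr 1
    refine Finset.sum_congr rfl fun i _ => ?_
    rw [NNReal.coe_div, NNReal.coe_mul, NNReal.coe_natCast, NNReal.coe_natCast]
    field_simp
  rw [h2, abs_mul, abs_of_pos (by positivity)]
  calc T / L * |∑ i, x (f i)| ≤ T / L * (η * L) := by gcongr
    _ = η * T := by field_simp

theorem Succeeds.resample {Q : Type u} {J A : Type} [Fintype J] [Inhabited A] (O : Q → Bool)
    {w : J → ℝ≥0} {m e : J → ℕ} {b L : ℕ} {η : ℝ} (a : J → A) (g : A → ℕ) (hg : ∀ j, g (a j) = m j)
    (hb : 1 ≤ b) (hm : ∀ j, m j ≤ b * e j) (he : ∀ j, e j ≤ 16 * m j) (hL : 0 < L) (hη : 0 < η)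
    (hη1 : η ≤ 1) :
    Succeeds O (resample L a w e)
      (fun st => |∑ k, ((st k).2 : ℝ) * g (st k).1 - ∑ j, (w j : ℝ) * m j| ≤
        η * ∑ j, (w j : ℝ) * m j)
      (2 * ENNReal.ofReal (Real.exp (-(L * η ^ 2 / (4 * (16 * b : ℝ) ^ 2))))) := by
  unfold HyperedgeEstimation.resample
  split_ifs with h
  · refine ((Succeeds.draw (iid_weightPMF hb hm he hL hη hη1 h) O).bind (δ' := 0)
      fun f hf => Succeeds.output O ?_).mono (fun _ h => h) (add_zero _).le
    simpa only [hg] using hf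
  · refine (Succeeds.output O ?_).mono (fun _ h => h) zero_le
    have h0 : ∀ j, (w j : ℝ) * m j = 0 := by
      intro j
      have h1 := (Finset.sum_eq_zero_iff.mp (not_not.mp h)) j (Finset.mem_univ j)
      rcases mul_eq_zero.mp h1 with h2 | h2
      · simp [h2]
      · have h3 : e j = 0 := by exact_mod_cast h2
        have h4 : m j = 0 := by have := hm j; rw [h3] at this; omega
        simp [h4]
    simp [h0]

theorem QueryBound.resample {Q : Type u} {J A : Type} [Fintype J] [Inhabited A] (O : Q → Bool)
    (L : ℕ) (a : J → A) (w : J → ℝ≥0) (e : J → ℕ) : QueryBound O (resample L a w e) 0 := by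
  unfold HyperedgeEstimation.resample
  split_ifs with h
  · exact (QueryBound.draw _ O).bind fun f => QueryBound.output O _
  · exact QueryBound.output O _

/-! ### Dyadic cells and the descent from the full box to points -/

/-- The points of `S` whose coordinates, after a shift by `s` bits, are `c`. -/
def cell {d n : ℕ} (S : Finset (Fin d → Fin n)) (s : ℕ) (c : Fin d → ℕ) :
    Finset (Fin d → Fin n) :=
  S.filter fun x => ∀ i, (x i : ℕ) / 2 ^ s = c i

/-- Bit `s` of each coordinate decides which of the 2^d parts of the cell contains a point. -/
theorem card_cell_succ {d n : ℕ} (S : Finset (Fin d → Fin n)) (s : ℕ) (c : Fin d → ℕ) :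
    (cell S (s + 1) c).card =
      ∑ δ : Fin d → Fin 2, (cell S s fun i => 2 * c i + δ i).card := by
  rw [Finset.card_eq_sum_card_fiberwise (t := Finset.univ)
    (f := fun x i => (⟨(x i : ℕ) / 2 ^ s % 2, Nat.mod_lt _ two_pos⟩ : Fin 2))
    (fun _ _ => Finset.mem_univ _)]
  refine Finset.sum_congr rfl fun δ _ => congrArg _ ?_
  ext x
  simp only [cell, Finset.mem_filter, and_assoc, funext_iff, ← forall_and, Fin.ext_iff]
  refine and_congr_right fun _ => forall_congr' fun i => ?_
  rw [pow_succ, ← Nat.div_div_eq_div_mul]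
  have := (δ i).2
  omega

theorem cell_zero_card {d n : ℕ} (S : Finset (Fin d → Fin n)) (c : Fin d → ℕ) :
    (cell S 0 c).card ≤ 1 := by
  refine Finset.card_le_one.mpr fun x hx y hy => funext fun i => Fin.ext ?_
  have h1 := (Finset.mem_filter.mp hx).2 i
  have h2 := (Finset.mem_filter.mp hy).2 i
  rw [pow_zero, Nat.div_one] at h1 h2
  rw [h1, h2]

theorem cell_top {d n ℓ : ℕ} (hn : n ≤ 2 ^ ℓ) (S : Finset (Fin d → Fin n)) :
    cell S ℓ (fun _ => 0) = S :=
  Finset.filter_true_of_mem fun x _ i => Nat.div_eq_of_lt ((x i).2.trans_le hn)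

open Classical in
/-- The oracle that tells whether a box contains a point of `S`. -/
noncomputable def boxOracle {d n : ℕ} (S : Finset (Fin d → Fin n)) (B : Fin d → Set (Fin n)) :
    Bool :=
  decide (∃ x ∈ S, ∀ i, x i ∈ B i)

/-- The box query that asks whether a cell contains a point of `S`. -/
def cellBox {d n : ℕ} (s : ℕ) (c : Fin d → ℕ) (i : Fin d) : Set (Fin n) :=
  {v | (v : ℕ) / 2 ^ s = c i}

/-- The box query that asks whether a point of `S` in a cell survives the hash functions. -/
def trialBox {d n ℓ : ℕ} (s : ℕ) (c : Fin d → ℕ) (h : Hash d n ℓ) (q : Fin d → ℕ) (i : Fin d) :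
    Set (Fin n) :=
  {v | (v : ℕ) / 2 ^ s = c i ∧ (h i v : ℕ) < 2 ^ (ℓ - q i)}

open Classical in
theorem boxOracle_trialBox {d n ℓ : ℕ} (S : Finset (Fin d → Fin n)) (s : ℕ) (c : Fin d → ℕ)
    (h : Hash d n ℓ) (q : Fin d → ℕ) :
    boxOracle S (trialBox s c h q) = decide (Hits (cell S s c) h q) := by
  rw [boxOracle, decide_eq_decide]
  simp only [Hits, cell, trialBox, Finset.mem_filter, Set.mem_ofPred_eq, forall_and, and_assoc]

theorem boxOracle_cellBox {d n : ℕ} (S : Finset (Fin d → Fin n)) (c : Fin d → ℕ) :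
    ((cell S 0 c).card : ℝ) = if boxOracle S (cellBox 0 c) then 1 else 0 := by
  have h1 : boxOracle S (cellBox 0 c) = true ↔ (cell S 0 c).Nonempty := by
    simp [boxOracle, cellBox, cell, Finset.Nonempty]
  split_ifs with h
  · have := (h1.mp h).card_pos
    have := cell_zero_card S c
    exact_mod_cast (by omega : (cell S 0 c).card = 1)
  · rw [h1, Finset.not_nonempty_iff_eq_empty] at h
    simp [h]

/-- The weighted number of points of `S` in a list of weighted cells. -/
noncomputable def mass {d n L : ℕ} (S : Finset (Fin d → Fin n)) (s : ℕ)
    (st : Fin L → (Fin d → ℕ) × ℝ≥0) : ℝ :=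
  ∑ k, ((st k).2 : ℝ) * (cell S s (st k).1).card

/-- Replace a list of weighted cells by a list of weighted cells of half the side length: split
the cells, estimate the number of points in the parts, and resample accordingly. -/
noncomputable def halve {d n ℓ r L : ℕ} (G : Fin r → Hash d n ℓ) (s : ℕ)
    (st : Fin L → (Fin d → ℕ) × ℝ≥0) :
    RandAlg (Fin d → Set (Fin n)) (Fin L → (Fin d → ℕ) × ℝ≥0) :=
  let part (j : Fin L × (Fin d → Fin 2)) (i : Fin d) : ℕ := 2 * (st j.1).1 i + j.2 i
  (askAll fun p : (Fin L × (Fin d → Fin 2)) × Fin r × (Fin d → Fin (ℓ + 1)) =>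
    trialBox s (part p.1) (G p.2.1) fun i => (p.2.2 i : ℕ)).bind fun ans =>
    resample L part (fun j => (st j.1).2) fun j => scale fun i q => ans (j, i, q)

/-- All estimates of cells are accurate up to the guaranteed factors. -/
def Accurate {d n ℓ r : ℕ} (S : Finset (Fin d → Fin n)) (G : Fin r → Hash d n ℓ) : Prop :=
  ∀ s ≤ ℓ, ∀ c, (cell S s c).card ≤ loss d ℓ * estimate (cell S s c) G ∧
    estimate (cell S s c) G ≤ 16 * (cell S s c).card

theorem one_le_loss (d ℓ : ℕ) : 1 ≤ loss d ℓ := Nat.one_le_pow _ _ (by positivity)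

/-- The failure probability of a round of resampling. -/
noncomputable def roundFailure (d ℓ L : ℕ) (η : ℝ) : ℝ≥0∞ :=
  2 * ENNReal.ofReal (Real.exp (-(L * η ^ 2 / (4 * (16 * loss d ℓ : ℝ) ^ 2))))

/-- Splitting preserves mass exactly, so the only error is that of resampling, with b = `loss d ℓ`.
-/
theorem Succeeds.halve {d n ℓ r L : ℕ} {S : Finset (Fin d → Fin n)} {G : Fin r → Hash d n ℓ}
    (hG : Accurate S G) {s : ℕ} (hs : s ≤ ℓ) (hL : 0 < L) {η : ℝ} (hη : 0 < η) (hη1 : η ≤ 1)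
    (st : Fin L → (Fin d → ℕ) × ℝ≥0) :
    Succeeds (boxOracle S) (halve G s st)
      (fun st' => |mass S s st' - mass S (s + 1) st| ≤ η * mass S (s + 1) st)
      (roundFailure d ℓ L η) := by
  refine ((Succeeds.askAll _ _).bind fun ans hans => ?_).mono (fun _ h => h) (zero_add _).le
  subst hans
  set part : Fin L × (Fin d → Fin 2) → Fin d → ℕ := fun j i => 2 * (st j.1).1 i + j.2 i
  have hmass : mass S (s + 1) st = ∑ j, ((st j.1).2 : ℝ) * (cell S s (part j)).card := by
    rw [Fintype.sum_prod_type, mass]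
    refine Finset.sum_congr rfl fun k _ => ?_
    rw [card_cell_succ, Nat.cast_sum, Finset.mul_sum]
  rw [hmass]
  refine Succeeds.resample _ part (fun c => (cell S s c).card) (fun _ => rfl) (one_le_loss d ℓ)
    (fun j => ?_) (fun j => ?_) hL hη hη1
  · simpa only [boxOracle_trialBox, estimate] using (hG s hs (part j)).1
  · simpa only [boxOracle_trialBox, estimate] using (hG s hs (part j)).2

theorem QueryBound.halve {d n ℓ r L : ℕ} (O : (Fin d → Set (Fin n)) → Bool)
    (G : Fin r → Hash d n ℓ) (s : ℕ) (st : Fin L → (Fin d → ℕ) × ℝ≥0) :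
    QueryBound O (halve G s st) (L * 2 ^ d * (r * (ℓ + 1) ^ d)) := by
  refine ((QueryBound.askAll _ O).bind fun ans => QueryBound.resample O _ _ _ _).mono ?_
  simp

/-- Halve the cells until they are points, and then add up the weights of the points of `S`. -/
noncomputable def descend {d n ℓ r L : ℕ} (G : Fin r → Hash d n ℓ) :
    ℕ → (Fin L → (Fin d → ℕ) × ℝ≥0) → RandAlg (Fin d → Set (Fin n)) ℝ
  | 0, st => (askAll fun k => cellBox 0 (st k).1).bind fun ans =>
      .output (∑ k, ((st k).2 : ℝ) * if ans k then 1 else 0)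
  | s + 1, st => (halve G s st).bind fun st' => descend G s st'

theorem Succeeds.descend {d n ℓ r L : ℕ} {S : Finset (Fin d → Fin n)} {G : Fin r → Hash d n ℓ}
    (hG : Accurate S G) (hL : 0 < L) {η : ℝ} (hη : 0 < η) (hη1 : η ≤ 1) {s : ℕ} (hs : s ≤ ℓ)
    (st : Fin L → (Fin d → ℕ) × ℝ≥0) :
    Succeeds (boxOracle S) (descend G s st)
      (fun x => (1 - η) ^ s * mass S s st ≤ x ∧ x ≤ (1 + η) ^ s * mass S s st)
      (s * roundFailure d ℓ L η) := by
  induction s generalizing st with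
  | zero =>
    refine ((Succeeds.askAll _ _).bind (δ' := 0) fun ans hans => Succeeds.output _ ?_).mono
      (fun _ h => h) (by simp)
    subst hans
    simp [mass, boxOracle_cellBox]
  | succ s ih =>
    refine ((Succeeds.halve hG (by omega) hL hη hη1 st).bind fun st' hst' =>
      (ih (by omega) st').mono (fun x hx => ?_) le_rfl).mono (fun _ h => h) ?_
    · have h1 := abs_le.mp hst'
      have h2 : 0 ≤ (1 - η) ^ s := pow_nonneg (by linarith) s
      have h3 : 0 ≤ (1 + η) ^ s := pow_nonneg (by linarith) s
      constructor
      · refine le_trans ?_ hx.1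
        rw [pow_succ, mul_assoc]
        exact mul_le_mul_of_nonneg_left (by linarith) h2
      · refine hx.2.trans ?_
        rw [pow_succ, mul_assoc]
        exact mul_le_mul_of_nonneg_left (by linarith) h3
    · rw [Nat.cast_add, Nat.cast_one, add_mul, one_mul, add_comm]

theorem QueryBound.descend {d n ℓ r L : ℕ} (O : (Fin d → Set (Fin n)) → Bool)
    (G : Fin r → Hash d n ℓ) (s : ℕ) (st : Fin L → (Fin d → ℕ) × ℝ≥0) :
    QueryBound O (descend G s st) (s * (L * 2 ^ d * (r * (ℓ + 1) ^ d)) + L) := by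
  induction s generalizing st with
  | zero =>
    refine ((QueryBound.askAll _ O).bind fun ans => QueryBound.output O _).mono ?_
    simp
  | succ s ih =>
    refine ((QueryBound.halve O G s st).bind fun st' => ih st').mono ?_
    rw [add_mul, one_mul]
    omega

/-- The estimation algorithm: draw the hash functions, then descend from the full box. -/
noncomputable def estimateCard (d n ℓ r L : ℕ) : RandAlg (Fin d → Set (Fin n)) ℝ :=
  (draw (iid (PMF.uniformOfFintype (Hash d n ℓ)) r)).bind fun G =>
    -- L copies of the full box with weight 1 / L: the initial mass is |S|, and all states have the
    -- same length.
    descend G ℓ fun _ : Fin L => (fun _ => 0, (L : ℝ≥0)⁻¹)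

/-- A union bound over all levels and all cells with indices below 2^ℓ; cells beyond are empty and
estimated as 0. Since every cell is covered at once, the same hash functions serve all rounds,
although the visited cells depend on earlier answers and draws. -/
theorem accurate_fails {d n ℓ : ℕ} (hn : n ≤ 2 ^ ℓ) (r : ℕ) (S : Finset (Fin d → Fin n)) :
    (iid (PMF.uniformOfFintype (Hash d n ℓ)) r).toOuterMeasure {G | ¬ Accurate S G} ≤
      ((ℓ + 1) * (2 ^ ℓ) ^ d : ℕ) * (2 * ((ℓ + 1) ^ d : ℕ) * 2⁻¹ ^ r) := by
  set bad : Fin (ℓ + 1) × (Fin d → Fin (2 ^ ℓ)) → Set (Fin r → Hash d n ℓ) := fun p =>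
    {G | ¬ ((cell S p.1 fun i => p.2 i).card ≤
        loss d ℓ * estimate (cell S p.1 fun i => p.2 i) G ∧
      estimate (cell S p.1 fun i => p.2 i) G ≤ 16 * (cell S p.1 fun i => p.2 i).card)}
  have hsub : {G : Fin r → Hash d n ℓ | ¬ Accurate S G} ⊆ ⋃ p, bad p := by
    intro G hG
    by_contra hnot
    simp only [Set.mem_iUnion, not_exists] at hnot
    refine hG fun s hs c => ?_
    by_cases hc : ∀ i, c i < 2 ^ ℓ
    · exact not_not.mp (hnot (⟨s, Nat.lt_succ_of_le hs⟩, fun i => ⟨c i, hc i⟩))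
    · have hempty : cell S s c = ∅ := by
        refine Finset.filter_false_of_mem fun x _ hx => hc fun i => ?_
        rw [← hx i]
        exact (Nat.div_le_self _ _).trans_lt ((x i).2.trans_le hn)
      simp [hempty, estimate_empty]
  calc _ ≤ _ := MeasureTheory.measure_mono hsub
    _ ≤ ∑ p, (iid (PMF.uniformOfFintype (Hash d n ℓ)) r).toOuterMeasure (bad p) :=
        MeasureTheory.measure_iUnion_fintype_le _ _
    _ ≤ ∑ _p : Fin (ℓ + 1) × (Fin d → Fin (2 ^ ℓ)), (2 : ℝ≥0∞) * ((ℓ + 1) ^ d : ℕ) * 2⁻¹ ^ r :=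
        Finset.sum_le_sum fun p _ => estimate_fails hn r _
    _ = _ := by simp

theorem Succeeds.estimateCard {d n ℓ r L : ℕ} (hn : n ≤ 2 ^ ℓ) (hL : 0 < L) {η : ℝ} (hη : 0 < η)
    (hη1 : η ≤ 1) (S : Finset (Fin d → Fin n)) :
    Succeeds (boxOracle S) (estimateCard d n ℓ r L)
      (fun x => (1 - η) ^ ℓ * S.card ≤ x ∧ x ≤ (1 + η) ^ ℓ * S.card)
      (((ℓ + 1) * (2 ^ ℓ) ^ d : ℕ) * (2 * ((ℓ + 1) ^ d : ℕ) * 2⁻¹ ^ r) +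
        ℓ * roundFailure d ℓ L η) := by
  refine (Succeeds.draw (accurate_fails hn r S) _).bind fun G hG => ?_
  refine (Succeeds.descend hG hL hη hη1 le_rfl _).mono (fun x hx => ?_) le_rfl
  have hL' : (L : ℝ) ≠ 0 := by exact_mod_cast hL.ne'
  have hmass : mass S ℓ (fun _ : Fin L => ((fun _ => 0), (L : ℝ≥0)⁻¹)) = S.card := by
    simp [mass, cell_top hn, hL']
  rwa [hmass] at hx

theorem QueryBound.estimateCard (d n ℓ r L : ℕ) (O : (Fin d → Set (Fin n)) → Bool) :
    QueryBound O (estimateCard d n ℓ r L) (ℓ * (L * 2 ^ d * (r * (ℓ + 1) ^ d)) + L) :=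
  ((QueryBound.draw _ O).bind fun G => QueryBound.descend O G ℓ _).mono (zero_add _).le

/-! ### Choice of parameters -/

/-- With N = 2^ℓ the union bound costs at most 2 N^(2d+1), and (6d + 3) ℓ trials contribute
N^(-6d-3). The remaining 2 / N² is at most 1/2 because N ≥ 2. -/
theorem trials_failure_le {d ℓ : ℕ} (hℓ : 1 ≤ ℓ) :
    (((ℓ + 1) * (2 ^ ℓ) ^ d : ℕ) * (2 * ((ℓ + 1) ^ d : ℕ) * 2⁻¹ ^ ((6 * d + 3) * ℓ)) : ℝ≥0∞) ≤
      ENNReal.ofReal (1 / (2 * ((2 : ℝ) ^ ℓ) ^ (4 * d))) := by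
  have h1 : (((ℓ + 1) * (2 ^ ℓ) ^ d : ℕ) * (2 * ((ℓ + 1) ^ d : ℕ) * 2⁻¹ ^ ((6 * d + 3) * ℓ)) :
      ℝ≥0∞) = ENNReal.ofReal (((ℓ + 1) * (2 ^ ℓ) ^ d : ℕ) *
        (2 * ((ℓ + 1) ^ d : ℕ) * 2⁻¹ ^ ((6 * d + 3) * ℓ))) := by
    rw [ENNReal.ofReal_mul (by positivity), ENNReal.ofReal_mul (by positivity),
      ENNReal.ofReal_mul (by positivity), ENNReal.ofReal_natCast, ENNReal.ofReal_natCast,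
      ENNReal.ofReal_pow (by positivity), ENNReal.ofReal_inv_of_pos two_pos]
    norm_num
  rw [h1]
  refine ENNReal.ofReal_le_ofReal ?_
  set N : ℝ := 2 ^ ℓ with hN
  have hN2 : 2 ≤ N := le_self_pow₀ one_le_two (by omega)
  have hℓN : (ℓ : ℝ) + 1 ≤ N := by
    rw [hN]
    exact_mod_cast Nat.lt_two_pow_self (n := ℓ)
  have hpow : ((2 : ℝ)⁻¹) ^ ((6 * d + 3) * ℓ) = (N ^ (6 * d + 3))⁻¹ := by
    rw [mul_comm, pow_mul, inv_pow, inv_pow]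
  push_cast
  rw [hpow, ← hN]
  calc ((ℓ : ℝ) + 1) * N ^ d * (2 * ((ℓ : ℝ) + 1) ^ d * (N ^ (6 * d + 3))⁻¹)
      ≤ N * N ^ d * (2 * N ^ d * (N ^ (6 * d + 3))⁻¹) := by gcongr
    _ = (2 / N ^ 2) / N ^ (4 * d) := by field_simp; ring
    _ ≤ (1 / 2) / N ^ (4 * d) := by
        refine div_le_div_of_nonneg_right ?_ (by positivity)
        rw [div_le_div_iff₀ (by positivity) two_pos]
        nlinarith
    _ = _ := by field_simp

theorem rounds_failure_le {d ℓ L : ℕ} (hℓ : 1 ≤ ℓ) {η : ℝ}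
    (hL : ((4 * d + 3) * ℓ : ℕ) ≤ L * η ^ 2 / (4 * (16 * loss d ℓ : ℝ) ^ 2)) :
    ℓ * roundFailure d ℓ L η ≤ ENNReal.ofReal (1 / (2 * ((2 : ℝ) ^ ℓ) ^ (4 * d))) := by
  set N : ℝ := 2 ^ ℓ with hN
  have hN2 : 2 ≤ N := le_self_pow₀ one_le_two (by omega)
  have hℓN : (ℓ : ℝ) ≤ N := by
    rw [hN]
    exact_mod_cast (Nat.lt_two_pow_self (n := ℓ)).le
  have hexp : Real.exp (-(L * η ^ 2 / (4 * (16 * loss d ℓ : ℝ) ^ 2))) ≤ (N ^ (4 * d + 3))⁻¹ := by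
    rw [Real.exp_neg]
    refine inv_anti₀ (by positivity) (le_trans ?_ (Real.exp_le_exp.mpr hL))
    rw [hN, ← pow_mul, mul_comm ℓ, ← mul_one (((4 * d + 3) * ℓ : ℕ) : ℝ), Real.exp_nat_mul]
    gcongr
    linarith [Real.add_one_le_exp 1]
  have h2 : (ℓ * roundFailure d ℓ L η : ℝ≥0∞) =
      ENNReal.ofReal (ℓ * (2 * Real.exp (-(L * η ^ 2 / (4 * (16 * loss d ℓ : ℝ) ^ 2))))) := by
    rw [roundFailure, ENNReal.ofReal_mul (by positivity), ENNReal.ofReal_mul two_pos.le,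
      ENNReal.ofReal_natCast]
    norm_num
  rw [h2]
  refine ENNReal.ofReal_le_ofReal ?_
  calc _ ≤ N * (2 * (N ^ (4 * d + 3))⁻¹) := by gcongr
    _ = (2 / N ^ 2) / N ^ (4 * d) := by field_simp; ring
    _ ≤ (1 / 2) / N ^ (4 * d) := by
        refine div_le_div_of_nonneg_right ?_ (by positivity)
        rw [div_le_div_iff₀ (by positivity) two_pos]
        nlinarith
    _ = _ := by field_simp

theorem clog_le_log {n : ℕ} (hn : 2 ≤ n) : (Nat.clog 2 n : ℝ) ≤ 3 * Real.log n := by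
  have h1 : 2 ^ (Nat.clog 2 n - 1) < n := by
    have := Nat.pow_pred_clog_lt_self one_lt_two (by omega : 1 < n)
    simpa using this
  have h2 : ((Nat.clog 2 n - 1 : ℕ) : ℝ) * Real.log 2 ≤ Real.log n := by
    rw [← Real.log_pow]
    exact Real.log_le_log (by positivity) (by exact_mod_cast h1.le)
  have h3 : Real.log 2 ≤ Real.log n := Real.log_le_log two_pos (by exact_mod_cast hn)
  have h4 : 1 ≤ Nat.clog 2 n := Nat.clog_pos one_lt_two hn
  rw [Nat.cast_sub h4, Nat.cast_one] at h2
  -- The previous bounds give clog · log 2 ≤ 2 log n, and 2 / log 2 < 3.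
  have h5 := Real.log_two_gt_d9
  nlinarith

/-- The size of a finite set of points can be estimated with few box queries. -/
theorem exists_estimateCard {d : ℕ} (hd : 1 ≤ d) :
    ∃ C : ℝ, 0 < C ∧ ∀ n : ℕ, 2 ≤ n → ∀ ε : ℝ, 0 < ε → ε < 1 →
      ∃ alg : RandAlg (Fin d → Set (Fin n)) ℝ, ∀ S : Finset (Fin d → Fin n),
        Succeeds (boxOracle S) alg (fun x => |(S.card : ℝ) - x| ≤ ε * S.card)
          (ENNReal.ofReal (1 / (n : ℝ) ^ (4 * d))) ∧
        ∃ N : ℕ, QueryBound (boxOracle S) alg N ∧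
          (N : ℝ) ≤ C * (ε⁻¹ ^ 4 * Real.log n ^ (5 * d + 4)) := by
  -- `A * ℓ ^ d` bounds the loss, as ℓ + 1 ≤ 2ℓ. In `B₁`, 8192 = 2 · 4 · 16² · 4, with 2 from
  -- rounding L up and the last 4 from η = ε / (2ℓ). In `B₂`, 4^d combines the 2^d parts with (ℓ +
  -- 1)^d ≤ 2^d ℓ^d, and the 1 pays for the final point queries.
  set A : ℝ := 2 ^ ((d + 6) * d) with hA
  set B₁ : ℝ := 8192 * A ^ 2 * (4 * d + 3) with hB₁
  set B₂ : ℝ := 4 ^ d * (6 * d + 3) + 1 with hB₂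
  refine ⟨B₁ * B₂ * 3 ^ (5 * d + 4), by positivity, fun n hn ε hε hε1 => ?_⟩
  set ℓ := Nat.clog 2 n with hℓdef
  have hℓ : 1 ≤ ℓ := Nat.clog_pos one_lt_two hn
  have hℓ' : (1 : ℝ) ≤ ℓ := by exact_mod_cast hℓ
  have hnℓ : n ≤ 2 ^ ℓ := Nat.le_pow_clog one_lt_two n
  -- Errors compound over ℓ rounds: (1 + η)^ℓ ≤ exp (ε/2) ≤ 1 + ε and (1 - η)^ℓ ≥ 1 - ε/2.
  set η : ℝ := ε / (2 * ℓ) with hη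
  have hη0 : 0 < η := by positivity
  have hηℓ : ℓ * η = ε / 2 := by rw [hη]; field_simp
  have hη1 : η ≤ 1 := by nlinarith
  have hloss1 : (1 : ℝ) ≤ loss d ℓ := by exact_mod_cast one_le_loss d ℓ
  -- The sample size at which the tail exponent of a round equals (4d + 3) ℓ.
  set X : ℝ := 4 * (16 * loss d ℓ) ^ 2 * ((4 * d + 3) * ℓ : ℕ) / η ^ 2 with hX
  set L := ⌈X⌉₊ with hLdef
  have hX1 : 1 ≤ X := by
    rw [hX, le_div_iff₀ (by positivity), one_mul]
    have hK : (1 : ℝ) ≤ ((4 * d + 3) * ℓ : ℕ) := by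
      exact_mod_cast Nat.one_le_iff_ne_zero.mpr (by positivity)
    have : η ^ 2 ≤ 1 := pow_le_one₀ hη0.le hη1
    nlinarith [mul_le_mul (show (1 : ℝ) ≤ (loss d ℓ : ℝ) ^ 2 by nlinarith) hK zero_le_one
      (by positivity)]
  have hL0 : 0 < L := Nat.ceil_pos.mpr (by linarith)
  have hXL : X ≤ L := Nat.le_ceil X
  have hLX : (L : ℝ) ≤ 2 * X := by linarith [Nat.ceil_lt_add_one (by linarith : 0 ≤ X)]
  set r := (6 * d + 3) * ℓ with hr
  refine ⟨estimateCard d n ℓ r L, fun S => ⟨?_, _, QueryBound.estimateCard d n ℓ r L _, ?_⟩⟩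
  · refine (Succeeds.estimateCard hnℓ hL0 hη0 hη1 S).mono (fun x hx => ?_) ?_
    · have h1 : 1 - ε ≤ (1 - η) ^ ℓ := by
        have := one_add_mul_le_pow (a := -η) (by linarith) ℓ
        rw [← sub_eq_add_neg] at this
        linarith
      have h2 : (1 + η) ^ ℓ ≤ 1 + ε := by
        have h3 : (1 + η) ^ ℓ ≤ Real.exp (ε / 2) := by
          rw [← hηℓ, Real.exp_nat_mul]
          have := Real.add_one_le_exp η
          gcongr
          linarith
        have h4 := (abs_le.mp (Real.abs_exp_sub_one_sub_id_le (x := ε / 2)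
          (by rw [abs_of_pos] <;> linarith))).2
        nlinarith
      have h5 : (0 : ℝ) ≤ S.card := Nat.cast_nonneg _
      rw [abs_le]
      constructor
      · nlinarith [mul_le_mul_of_nonneg_right h2 h5]
      · nlinarith [mul_le_mul_of_nonneg_right h1 h5]
    · have hround : (((4 * d + 3) * ℓ : ℕ) : ℝ) ≤
          L * η ^ 2 / (4 * (16 * loss d ℓ : ℝ) ^ 2) := by
        rw [le_div_iff₀ (by positivity)]
        rw [hX, div_le_iff₀ (by positivity)] at hXL
        linarith
      refine (add_le_add (trials_failure_le hℓ) (rounds_failure_le hℓ hround)).trans ?_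
      rw [← ENNReal.ofReal_add (by positivity) (by positivity)]
      refine ENNReal.ofReal_le_ofReal ?_
      have h6 : (n : ℝ) ≤ 2 ^ ℓ := by exact_mod_cast hnℓ
      calc _ = 1 / ((2 : ℝ) ^ ℓ) ^ (4 * d) := by field_simp; norm_num
        _ ≤ _ := by
          refine one_div_le_one_div_of_le ?_ ?_
          · have : (0 : ℝ) < n := by exact_mod_cast (by omega : 0 < n)
            positivity
          · gcongr
  · have hloss : (loss d ℓ : ℝ) ≤ A * ℓ ^ d := by
      have h1 : (loss d ℓ : ℝ) = ((ℓ + 1) * 2 ^ (d + 5)) ^ d := by simp [loss]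
      rw [h1, hA, pow_mul, ← mul_pow]
      refine pow_le_pow_left₀ (by positivity) ?_ d
      rw [show d + 6 = (d + 5) + 1 by rfl, pow_succ (2 : ℝ) (d + 5)]
      have : (0 : ℝ) < 2 ^ (d + 5) := by positivity
      nlinarith
    have hLle : (L : ℝ) ≤ B₁ * ℓ ^ (2 * d + 3) * ε⁻¹ ^ 2 := by
      refine hLX.trans ?_
      calc 2 * X ≤ 2 * (4 * (16 * (A * ℓ ^ d)) ^ 2 * ((4 * d + 3) * ℓ : ℕ) / η ^ 2) := by
            rw [hX]; gcongr
        _ = _ := by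
            rw [hη, hB₁]
            push_cast
            field_simp
            ring
    have hN : (((ℓ * (L * 2 ^ d * (r * (ℓ + 1) ^ d)) + L : ℕ)) : ℝ) ≤ L * (ℓ ^ (d + 2) * B₂) := by
      have h1 : ((ℓ : ℝ) + 1) ^ d ≤ 2 ^ d * ℓ ^ d := by
        rw [← mul_pow]
        exact pow_le_pow_left₀ (by positivity) (by linarith) d
      have h2 : (1 : ℝ) ≤ ℓ ^ (d + 2) := one_le_pow₀ hℓ'
      have h3 : (4 : ℝ) ^ d = 2 ^ d * 2 ^ d := by rw [← mul_pow]; norm_num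
      rw [hr]
      push_cast
      calc (ℓ : ℝ) * (L * 2 ^ d * ((6 * d + 3) * ℓ * (ℓ + 1) ^ d)) + L
          ≤ (ℓ : ℝ) * (L * 2 ^ d * ((6 * d + 3) * ℓ * (2 ^ d * ℓ ^ d))) + L * ℓ ^ (d + 2) := by
            gcongr
            exact le_mul_of_one_le_right (by positivity) h2
        _ = _ := by rw [hB₂, h3]; ring
    have hεinv : 1 ≤ ε⁻¹ := (one_le_inv₀ hε).mpr hε1.le
    have hlog : (ℓ : ℝ) ≤ 3 * Real.log n := clog_le_log hn
    calc _ ≤ _ := hN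
      _ ≤ (B₁ * ℓ ^ (2 * d + 3) * ε⁻¹ ^ 2) * (ℓ ^ (d + 2) * B₂) := by gcongr
      _ = B₁ * B₂ * ℓ ^ (3 * d + 5) * ε⁻¹ ^ 2 := by ring
      _ ≤ B₁ * B₂ * ℓ ^ (5 * d + 4) * ε⁻¹ ^ 4 := by
          -- 3d + 5 ≤ 5d + 4 because d ≥ 1.
          have h1 : (ℓ : ℝ) ^ (3 * d + 5) ≤ ℓ ^ (5 * d + 4) := pow_le_pow_right₀ hℓ' (by omega)
          have h2 : ε⁻¹ ^ 2 ≤ ε⁻¹ ^ 4 := pow_le_pow_right₀ hεinv (by norm_num)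
          gcongr
      _ ≤ B₁ * B₂ * (3 * Real.log n) ^ (5 * d + 4) * ε⁻¹ ^ 4 := by gcongr
      _ = _ := by rw [mul_pow]; ring

/-! ### From hypergraphs to point sets -/

theorem numHyperedges_ne_zero {V : Type u} [Finite V] (H : Hypergraph V) {ι : Type}
    (A : ι → Set V) : numHyperedges H A ≠ 0 ↔ ∃ f, f ∈ orderedHyperedges H A := by
  rw [numHyperedges, ← Nat.pos_iff_ne_zero, Set.ncard_pos (Set.toFinite _), hyperedges,
    Set.image_nonempty]
  rfl

open Classical in
/-- The ordered hyperedges of `H`, with the vertices numbered by `e`. -/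
noncomputable def numberedHyperedges {V : Type u} {n : ℕ} (e : V ≃ Fin n) (H : Hypergraph V)
    (d : ℕ) : Finset (Fin d → Fin n) :=
  Finset.univ.filter fun x => e.symm ∘ x ∈ orderedHyperedges H fun _ => Set.univ

/-- The query that asks whether a box, in terms of a numbering `e` of the vertices, contains an ordered
hyperedge. -/
def boxQuery {V : Type u} {n d : ℕ} (e : V ≃ Fin n) (B : Fin d → Set (Fin n)) : Query V d :=
  .gpis₂ fun i => e ⁻¹' B i

/-- GPIS₂ sets may overlap, so every box is a legal query; a hyperedge that it detects is witnessed
by an ordering lying in the box. -/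
theorem oracle_boxQuery {V : Type u} {n d : ℕ} (e : V ≃ Fin n) (H : Hypergraph V) :
    oracle H ∘ boxQuery e = boxOracle (numberedHyperedges e H d) := by
  have : Finite V := Finite.of_equiv _ e.symm
  funext B
  rw [Function.comp_apply, boxQuery, oracle, boxOracle, decide_eq_decide, numHyperedges_ne_zero]
  simp only [numberedHyperedges, Finset.mem_filter, Finset.mem_univ, true_and]
  constructor
  · rintro ⟨f, hf, hr, hB⟩
    have hef : e.symm ∘ e ∘ f = f := by funext i; simp
    exact ⟨e ∘ f, by rw [hef]; exact ⟨hf, hr, fun _ => Set.mem_univ _⟩, hB⟩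
  · rintro ⟨x, ⟨hx, hr, -⟩, hB⟩
    exact ⟨e.symm ∘ x, hx, hr, fun i => by simpa using hB i⟩

theorem card_numberedHyperedges {V : Type u} {n d : ℕ} (e : V ≃ Fin n) (H : Hypergraph V)
    (hH : H.vertexSet = Set.univ) : (numberedHyperedges e H d).card = totalOrdered H d := by
  rw [totalOrdered, numOrderedHyperedges, hH, ← Set.ncard_coe_finset]
  refine Set.ncard_congr (fun x _ => e.symm ∘ x) ?_ ?_ ?_
  · intro x hx
    simpa [numberedHyperedges] using hx
  · intro x y _ _ hxy
    exact e.symm.injective.comp_left hxy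
  · intro f hf
    have hef : e.symm ∘ e ∘ f = f := by funext i; simp
    exact ⟨e ∘ f, by simpa [numberedHyperedges, hef] using hf, hef⟩

open Classical in
-- The orderings of `s` are the bijections from `Fin d` onto `s`.
theorem card_orderings {V : Type u} [Fintype V] {d : ℕ} (s : Set V) (hs : s.ncard = d) :
    (Finset.univ.filter fun f : Fin d → V => Function.Injective f ∧ Set.range f = s).card =
      d.factorial := by
  have hcard : Fintype.card (Fin d) = Fintype.card s := by
    rw [Fintype.card_fin, ← hs, ← Nat.card_coe_set_eq, Nat.card_eq_fintype_card]
  have h1 : (Finset.univ.filter fun f : Fin d → V => Function.Injective f ∧ Set.range f = s) =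
      Finset.univ.image fun (g : Fin d ≃ s) i => (g i : V) := by
    ext f
    simp only [Finset.mem_filter, Finset.mem_univ, true_and, Finset.mem_image]
    constructor
    · rintro ⟨hf, rfl⟩
      exact ⟨Equiv.ofInjective f hf, rfl⟩
    · rintro ⟨g, rfl⟩
      refine ⟨Subtype.val_injective.comp g.injective, ?_⟩
      rw [← Function.comp_def, Set.range_comp, g.surjective.range_eq, Set.image_univ,
        Subtype.range_coe]
  rw [h1, Finset.card_image_of_injective, Finset.card_univ,
    Fintype.card_equiv (Fintype.equivOfCardEq hcard), Fintype.card_fin]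
  intro g g' h
  ext i
  exact congrFun h i

open Classical in
/-- Every hyperedge of a `d`-uniform hypergraph has `d!` orderings. -/
theorem totalOrdered_eq {V : Type u} [Fintype V] {d : ℕ} (H : Hypergraph V)
    (hH : H.vertexSet = Set.univ) (hunif : IsUniform H d) :
    totalOrdered H d = d.factorial * H.edgeSet.ncard := by
  have h1 : orderedHyperedges H (fun _ : Fin d => H.vertexSet) =
      ((Finset.univ.filter fun f : Fin d → V => Function.Injective f ∧ Set.range f ∈ H.edgeSet :
        Finset (Fin d → V)) : Set (Fin d → V)) := by
    ext f
    simp [orderedHyperedges, hH]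
  rw [totalOrdered, numOrderedHyperedges, h1, Set.ncard_coe_finset,
    Finset.card_eq_sum_card_fiberwise (f := Set.range) (t := H.edgeSet.toFinset)
      (fun f hf => by simpa using (Finset.mem_filter.mp hf).2.2)]
  have h2 : ∀ s ∈ H.edgeSet.toFinset, ((Finset.univ.filter fun f : Fin d → V =>
      Function.Injective f ∧ Set.range f ∈ H.edgeSet).filter fun f => Set.range f = s).card =
      d.factorial := by
    intro s hs
    have hs : s ∈ H.edgeSet := by simpa using hs
    rw [← card_orderings s (hunif s hs).2, Finset.filter_filter]
    congr 1
    ext f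
    simp only [Finset.mem_filter, Finset.mem_univ, true_and]
    constructor
    · rintro ⟨⟨h, -⟩, h'⟩
      exact ⟨h, h'⟩
    · rintro ⟨h, rfl⟩
      exact ⟨⟨h, hs⟩, rfl⟩
  rw [Finset.sum_congr rfl h2, Finset.sum_const, smul_eq_mul, mul_comm,
    Set.ncard_eq_toFinset_card']

theorem Succeeds.le_toOuterMeasure {Q : Type u} {R : Type} {O : Q → Bool} {a : RandAlg Q R}
    {P : R → Prop} {δ : ℝ≥0∞} (h : Succeeds O a P δ) :
    1 - δ ≤ (a.run O).toOuterMeasure {x | P x.1} := by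
  rw [tsub_le_iff_right]
  have h1 : (1 : ℝ≥0∞) = (a.run O).toOuterMeasure ({x | P x.1} ∪ {x | ¬ P x.1}) := by
    rw [eq_comm, PMF.toOuterMeasure_apply_eq_one_iff]
    intro x _
    exact em (P x.1)
  rw [h1]
  exact (MeasureTheory.measure_union_le _ _).trans (add_le_add le_rfl h)

end HyperedgeEstimation

/-! ### The main theorem -/

open HyperedgeEstimation in
theorem lemma2 (d : ℕ) (hd : 1 ≤ d) :
    ∃ C : ℝ, 0 < C ∧
      ∀ (V : Type*) [Fintype V] [Nonempty V] (n : ℕ), Fintype.card V = n →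
      ∀ ε : ℝ, 0 < ε → ε < 1 →
        ((n : ℝ) ^ (-(d : ℤ)) * Real.log n ^ (5 * d + 5)) ^ (1 / 4 : ℝ) ≤ ε →
        ∃ alg : RandAlg (Query V d) ℝ,
          ∀ H : Hypergraph V, H.vertexSet = Set.univ → IsUniform H d →
            -- the output approximates `m_o(H)`, and divided by `d!` it approximates `m(H)`
            ENNReal.ofReal (1 - 1 / (n : ℝ) ^ (4 * d)) ≤
                (alg.run (oracle H)).toOuterMeasure
                  {x | IsApprox ε x.1 (totalOrdered H d) ∧
                    IsApprox ε (x.1 / (d.factorial : ℝ)) (H.edgeSet.ncard : ℝ)} ∧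
            -- in every run, the number of queries is small
            ∀ x ∈ (alg.run (oracle H)).support,
              (x.2 : ℝ) ≤ C * (ε⁻¹ ^ 4 * Real.log n ^ (5 * d + 4)) := by
  obtain ⟨C, hC, hmain⟩ := exists_estimateCard hd
  refine ⟨C, hC, fun V _ _ n hn ε hε hε1 _ => ?_⟩
  have hn1 : 1 ≤ n := hn ▸ Fintype.card_pos
  rcases hn1.eq_or_lt with rfl | hn2
  -- For n = 1 the required success probability is 0, and log 1 = 0 leaves no queries, so any
  -- constant output serves.
  · refine ⟨.output 0, fun H _ _ => ⟨by simp, fun x hx => ?_⟩⟩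
    have hx2 : x.2 = 0 := Nat.le_zero.mp (QueryBound.output (oracle H) (0 : ℝ) x hx)
    rw [hx2]
    simp
  · obtain ⟨alg, halg⟩ := hmain n hn2 ε hε hε1
    let e := Fintype.equivFinOfCardEq hn
    refine ⟨alg.mapQuery (boxQuery e), fun H hH hunif => ?_⟩
    obtain ⟨hs, N, hN, hNle⟩ := halg (numberedHyperedges e H d)
    rw [RandAlg.run_mapQuery, oracle_boxQuery]
    constructor
    · have hs' := hs.mono (P' := fun x => IsApprox ε x (totalOrdered H d) ∧
        IsApprox ε (x / (d.factorial : ℝ)) (H.edgeSet.ncard : ℝ)) (fun x hx => ?_) le_rfl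
      · refine le_trans ?_ hs'.le_toOuterMeasure
        rw [ENNReal.ofReal_sub _ (by positivity), ENNReal.ofReal_one]
      · rw [card_numberedHyperedges e H hH] at hx
        refine ⟨hx, ?_⟩
        rw [totalOrdered_eq H hH hunif] at hx
        have hfac : (0 : ℝ) < d.factorial := by exact_mod_cast d.factorial_pos
        have h1 : (H.edgeSet.ncard : ℝ) - x / d.factorial =
            ((d.factorial * H.edgeSet.ncard : ℕ) - x) / d.factorial := by
          push_cast
          field_simp
        rw [IsApprox, h1, abs_div, abs_of_pos hfac, div_le_iff₀ hfac]
        refine hx.trans (le_of_eq ?_)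
        push_cast
        ring
    · intro x hx
      exact le_trans (by exact_mod_cast hN x hx) hNle
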